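/- Let $\mathcal K$ be a separable complex Hilbert space and let $J$ be a selfadjoint unitary operator on $\mathcal K$. A bounded operator $H$ on $\mathcal K$ is called $J$-hermitian if $H^*J=JH$, and a $J$-hermitian operator $H$ is called $\mathbb R$-Fredholm if $H-\lambda\mathbf 1$ is a Fredholm operator for every $\lambda\in\mathbb R$. Let $\mathbb{FH}(\mathcal K,J)$ be the set of $J$-hermitian $\mathbb R$-Fredholm operators, equipped with the topology of the operator norm. For $H\in\mathbb{FH}(\mathcal K,J)$ the real spectrum of $H$ is a finite set, and it consists of discrete eigenvalues, that is, of eigenvalues $\lambda$ which are isolated points of the spectrum of $H$ and whose Riesz projection $P_\lambda=\frac{1}{2\pi i}\oint_{|z-\lambda|=r}(z\mathbf 1-H)^{-1}\,dz$ ($r>0$ small) has finite rank. For a real eigenvalue $\lambda$ of $H$ let $\nu_+(\lambda,H)$ and $\nu_-(\lambda,H)$ be the numbers of positive and of negative eigenvalues, counted with multiplicity, of the hermitian form $(v,w)\mapsto\langle v,Jw\rangle$ restricted to the range of $P_\lambda$, and let $\mathrm{Sig}(\lambda,H)=\nu_+(\lambda,H)-\nu_-(\lambda,H)$ be the Krein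 signature of $\lambda$. Define the global Krein signature as the (finite) sum $$\mathrm{Sig}(H)=\sum_{\lambda}\mathrm{Sig}(\lambda,H)\in\mathbb Z$$ over all real eigenvalues $\lambda$ of $H$. Then the map $H\in\mathbb{FH}(\mathcal K,J)\mapsto\mathrm{Sig}(H)\in\mathbb Z$ is continuous. Consequently it is a homotopy invariant: if $H_0$ and $H_1$ are joined by a norm continuous path in $\mathbb{FH}(\mathcal K,J)$, then $\mathrm{Sig}(H_0)=\mathrm{Sig}(H_1)$. -/

import Mathlib

open scoped InnerProductSpace

noncomputable section

/-- A fundamental symmetry on a complex Hilbert space: a selfadjoint unitary operator `J`. -/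
structure IsFundamentalSymmetry {K : Type*} [NormedAddCommGroup K] [InnerProductSpace ℂ K]
    [CompleteSpace K] (J : K →L[ℂ] K) : Prop where
  isSelfAdjoint : IsSelfAdjoint J
  mem_unitary : J ∈ unitary (K →L[ℂ] K)

/-- A bounded operator `H` is `J`-hermitian if `H* J = J H`. -/
def IsJHermitian {K : Type*} [NormedAddCommGroup K] [InnerProductSpace ℂ K]
    [CompleteSpace K] (J H : K →L[ℂ] K) : Prop :=
  ContinuousLinearMap.adjoint H ∘L J = J ∘L H

/-- The set of `J`-hermitian `ℝ`-Fredholm operators: the bounded `J`-hermitian operators `H` such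
that `H - x` is a Fredholm operator for every real number `x`. As a subtype of the space of bounded
operators it carries the norm topology. -/
def fredholmJHermitian {K : Type*} [NormedAddCommGroup K] [InnerProductSpace ℂ K]
    [CompleteSpace K] (J : K →L[ℂ] K) : Set (K →L[ℂ] K) :=
  {H | IsJHermitian J H ∧
    ∀ x : ℝ, (H - (x : ℂ) • ContinuousLinearMap.id ℂ K).IsFredholm}

/-- The radius `r > 0` separates the point `z` from the rest of the spectrum of `A`: the closed
disc of radius `r` around `z` contains no point of the spectrum except possibly `z`. -/
def IsSeparatingRadius {K : Type*} [NormedAddCommGroup K] [InnerProductSpace ℂ K]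
    (A : K →L[ℂ] K) (z : ℂ) (r : ℝ) : Prop :=
  0 < r ∧ spectrum ℂ A ∩ Metric.closedBall z r ⊆ {z}

/-- The contour integral `(2πi)⁻¹ ∮ (w - A)⁻¹ dw` over the circle of radius `r` around `z`. -/
def rieszIntegral {K : Type*} [NormedAddCommGroup K] [InnerProductSpace ℂ K]
    (A : K →L[ℂ] K) (z : ℂ) (r : ℝ) : K →L[ℂ] K :=
  (2 * (Real.pi : ℂ) * Complex.I)⁻¹ • ∮ w in C(z, r), resolvent A w

open Classical in
/-- The Riesz spectral projection of `A` at the point `z`: the contour integral of the resolvent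
over a circle around `z` whose closed disc contains no other point of the spectrum (all such circles
give the same value). It vanishes at points of the resolvent set, and is set to zero if there is no
such circle, that is, if `z` is a limit point of the spectrum. -/
def rieszProjection {K : Type*} [NormedAddCommGroup K] [InnerProductSpace ℂ K]
    (A : K →L[ℂ] K) (z : ℂ) : K →L[ℂ] K :=
  if h : ∃ r : ℝ, IsSeparatingRadius A z r then rieszIntegral A z h.choose else 0

/-- The range of the Riesz projection of `A` at `z`. -/
def rieszSpace {K : Type*} [NormedAddCommGroup K] [InnerProductSpace ℂ K]
    (A : K →L[ℂ] K) (z : ℂ) : Submodule ℂ K :=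
  (rieszProjection A z : K →ₗ[ℂ] K).range

/-- A discrete eigenvalue of `A`: an eigenvalue that is an isolated point of the spectrum and whose
Riesz projection has finite rank. -/
structure IsDiscreteEigenvalue {K : Type*} [NormedAddCommGroup K] [InnerProductSpace ℂ K]
    (A : K →L[ℂ] K) (z : ℂ) : Prop where
  hasEigenvalue : Module.End.HasEigenvalue (A : K →ₗ[ℂ] K) z
  isolated : ∃ r : ℝ, 0 < r ∧ spectrum ℂ A ∩ Metric.closedBall z r = {z}
  finiteDimensional : FiniteDimensional ℂ (rieszSpace A z)

/-- The eigenspace, for the real number `t`, of the sesquilinear form `(w, v) ↦ ⟪w, J v⟫`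
restricted to the subspace `E`: all `v ∈ E` with `⟪w, J v⟫ = t ⟪w, v⟫` for every `w ∈ E`. It is the
eigenspace of the compression of `J` to `E`. -/
def formEigenspace {K : Type*} [NormedAddCommGroup K] [InnerProductSpace ℂ K]
    (J : K →L[ℂ] K) (E : Submodule ℂ K) (t : ℝ) : Submodule ℂ K where
  carrier := {v | v ∈ E ∧ ∀ w ∈ E, ⟪w, J v⟫_ℂ = (t : ℂ) * ⟪w, v⟫_ℂ}
  zero_mem' := by simp
  add_mem' := by
    rintro a b ⟨ha, ha'⟩ ⟨hb, hb'⟩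
    refine ⟨E.add_mem ha hb, fun w hw => ?_⟩
    rw [map_add, inner_add_right, inner_add_right, ha' w hw, hb' w hw, mul_add]
  smul_mem' := by
    rintro c a ⟨ha, ha'⟩
    refine ⟨E.smul_mem c ha, fun w hw => ?_⟩
    rw [map_smul, inner_smul_right, inner_smul_right, ha' w hw, mul_left_comm]

/-- The number `ν₊` of positive eigenvalues, with multiplicity, of the form `J` restricted to the
(finite dimensional) subspace `E`. -/
def positiveInertia {K : Type*} [NormedAddCommGroup K] [InnerProductSpace ℂ K]
    (J : K →L[ℂ] K) (E : Submodule ℂ K) : ℕ :=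
  ∑ᶠ (t : ℝ) (_ : 0 < t), Module.finrank ℂ (formEigenspace J E t)

/-- The number `ν₋` of negative eigenvalues, with multiplicity, of the form `J` restricted to the
(finite dimensional) subspace `E`. -/
def negativeInertia {K : Type*} [NormedAddCommGroup K] [InnerProductSpace ℂ K]
    (J : K →L[ℂ] K) (E : Submodule ℂ K) : ℕ :=
  ∑ᶠ (t : ℝ) (_ : t < 0), Module.finrank ℂ (formEigenspace J E t)

/-- The Krein signature `ν₊ - ν₋` of the real number `x` with respect to `H`, for the form `J`
restricted to the range of the Riesz projection of `H` at `x`. It is zero if `x` is not in the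
spectrum of `H`. -/
def kreinSignature {K : Type*} [NormedAddCommGroup K] [InnerProductSpace ℂ K]
    (J H : K →L[ℂ] K) (x : ℝ) : ℤ :=
  (positiveInertia J (rieszSpace H (x : ℂ)) : ℤ) - negativeInertia J (rieszSpace H (x : ℂ))

/-- The global Krein signature: the sum of the Krein signatures of all real eigenvalues. -/
def globalKreinSignature {K : Type*} [NormedAddCommGroup K] [InnerProductSpace ℂ K]
    (J H : K →L[ℂ] K) : ℤ :=
  ∑ᶠ (x : ℝ) (_ : Module.End.HasEigenvalue (H : K →ₗ[ℂ] K) (x : ℂ)), kreinSignature J H x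

end

/-! For real `x` and `J`-hermitian `H`, the operator `J (H - x)` is selfadjoint. If `H - x` is
Fredholm, adding the orthogonal projection onto the kernel makes it invertible, so `H` is a finite
rank perturbation of some `B` with `x` in its resolvent set (`exists_finiteRank_perturbation`). Near
`x` the spectrum of `H` is the zero set of an analytic perturbation determinant. Isolation of zeros,
connectedness of the real line and boundedness of the spectrum make the real spectrum finite
(`finite_real_spectrum`), and compactness of `B - H` makes the Riesz projections of finite rank.

Generalized eigenspaces at `z` and `w` are orthogonal for the form of `J` unless `w` is the
conjugate of `z`. Hence, when the Riesz projection of a circle with real center has finite rank, the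
form is nondegenerate on its range, which splits into the spaces at real points and a
form-orthogonal complement spanned by two neutral subspaces, from the upper and the lower half
plane. That complement has signature zero, so the signature of the whole range is the sum of the
Krein signatures inside the circle (`formSignature_contourSpace`).

The Riesz projection of a fixed circle depends continuously on the operator, and the inertia of a
nondegenerate form on the range of an idempotent of finite rank does not change under small
perturbations (`HasInertia.eventually_range`). Real eigenvalues may therefore split or leave the
axis in conjugate pairs without changing the total in each disc. The compact part of the real line
outside the discs stays in the resolvent set, so the global signature is locally constant
(`eventually_globalKreinSignature_eq`). -/

noncomputable section

set_option linter.unusedSectionVars false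

open Metric Filter Topology

/-! ### Contour integrals of the resolvent in a Banach algebra. -/

section RieszBanach

variable {𝔸 : Type*} [NormedRing 𝔸] [NormedAlgebra ℂ 𝔸] [CompleteSpace 𝔸]

theorem ContinuousLinearMap.map_circleIntegral {E F : Type*} [NormedAddCommGroup E]
    [NormedSpace ℂ E] [CompleteSpace E] [NormedAddCommGroup F] [NormedSpace ℂ F] [CompleteSpace F]
    (L : E →L[ℂ] F) {f : ℂ → E} {c : ℂ} {r : ℝ} (hf : CircleIntegrable f c r) :
    L (∮ z in C(c, r), f z) = ∮ z in C(c, r), L (f z) := by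
  simp only [circleIntegral]
  rw [← ContinuousLinearMap.intervalIntegral_comp_comm L hf.out]
  simp

theorem continuousOn_resolvent (a : 𝔸) : ContinuousOn (resolvent a) (resolventSet ℂ a) :=
  fun _ hz => (spectrum.hasDerivAt_resolvent_const_left hz).continuousAt.continuousWithinAt

theorem differentiableOn_resolvent (a : 𝔸) :
    DifferentiableOn ℂ (resolvent a) (resolventSet ℂ a) :=
  fun _ hz => (spectrum.hasDerivAt_resolvent_const_left hz).differentiableAt.differentiableWithinAt

theorem sub_mul_resolvent {a : 𝔸} {z : ℂ} (hz : z ∈ resolventSet ℂ a) :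
    (algebraMap ℂ 𝔸 z - a) * resolvent a z = 1 := Ring.mul_inverse_cancel _ hz

theorem resolvent_mul_sub {a : 𝔸} {z : ℂ} (hz : z ∈ resolventSet ℂ a) :
    resolvent a z * (algebraMap ℂ 𝔸 z - a) = 1 := Ring.inverse_mul_cancel _ hz

/-- The Riesz integral `(2πi)⁻¹ ∮ (z - a)⁻¹ dz` in a Banach algebra. -/
def contourProjection (a : 𝔸) (c : ℂ) (r : ℝ) : 𝔸 :=
  (2 * (Real.pi : ℂ) * Complex.I)⁻¹ • ∮ z in C(c, r), resolvent a z

/-- The Cauchy transform `(2πi)⁻¹ ∮ (z - w)⁻¹ (z - a)⁻¹ dz` of the resolvent. -/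
def cauchyResolvent (a : 𝔸) (c : ℂ) (r : ℝ) (w : ℂ) : 𝔸 :=
  (2 * (Real.pi : ℂ) * Complex.I)⁻¹ • ∮ z in C(c, r), (z - w)⁻¹ • resolvent a z

variable {a : 𝔸} {c : ℂ} {r : ℝ}

theorem circleIntegrable_resolvent (hr : 0 ≤ r) (h : sphere c r ⊆ resolventSet ℂ a) :
    CircleIntegrable (resolvent a) c r :=
  ((continuousOn_resolvent a).mono h).circleIntegrable hr

theorem circleIntegrable_inv_smul_resolvent (hr : 0 ≤ r) (h : sphere c r ⊆ resolventSet ℂ a)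
    {w : ℂ} (hw : w ∉ sphere c r) :
    CircleIntegrable (fun z => (z - w)⁻¹ • resolvent a z) c r := by
  refine ContinuousOn.circleIntegrable hr (ContinuousOn.smul ?_ ((continuousOn_resolvent a).mono h))
  refine ContinuousOn.inv₀ (by fun_prop) fun z hz h0 => hw ?_
  rwa [← sub_eq_zero.1 h0]

/-- Integrate the pointwise identity `(z - w)⁻¹ (w - a) R(z) = (z - w)⁻¹ - R(z)`. The Cauchy
transform thus inverts `w - a` up to the contour projection, with a scalar that is 1 inside the
circle and 0 outside. -/
theorem sub_mul_cauchyResolvent (hr : 0 ≤ r) (h : sphere c r ⊆ resolventSet ℂ a)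
    {w : ℂ} (hw : w ∉ sphere c r) :
    (algebraMap ℂ 𝔸 w - a) * cauchyResolvent a c r w =
      ((2 * (Real.pi : ℂ) * Complex.I)⁻¹ * ∮ z in C(c, r), (z - w)⁻¹) • 1
        - contourProjection a c r := by
  have hint : CircleIntegrable (fun z => (z - w)⁻¹) c r := by
    refine ContinuousOn.circleIntegrable hr (ContinuousOn.inv₀ (by fun_prop) fun z hz h0 => hw ?_)
    rwa [← sub_eq_zero.1 h0]
  have hint' : CircleIntegrable (fun z => (z - w)⁻¹ • (1 : 𝔸)) c r := by
    refine ContinuousOn.circleIntegrable hr (ContinuousOn.smul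
      (ContinuousOn.inv₀ (by fun_prop) fun z hz h0 => hw ?_) continuousOn_const)
    rwa [← sub_eq_zero.1 h0]
  have key := (ContinuousLinearMap.mul ℂ 𝔸 (algebraMap ℂ 𝔸 w - a)).map_circleIntegral
    (circleIntegrable_inv_smul_resolvent hr h hw)
  simp only [ContinuousLinearMap.mul_apply'] at key
  rw [cauchyResolvent, mul_smul_comm, key, contourProjection, mul_smul, ← smul_sub,
    ← circleIntegral.integral_smul_const, ← circleIntegral.integral_sub hint'
      (circleIntegrable_resolvent hr h)]
  congr 1
  refine circleIntegral.integral_congr hr fun z hz => ?_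
  have hzw : z - w ≠ 0 := fun h0 => hw (by rwa [← sub_eq_zero.1 h0])
  have e : algebraMap ℂ 𝔸 w - a = (algebraMap ℂ 𝔸 z - a) - (z - w) • 1 := by
    rw [Algebra.algebraMap_eq_smul_one, Algebra.algebraMap_eq_smul_one, sub_smul]; abel
  rw [mul_smul_comm, e, sub_mul, sub_mul_resolvent (h hz), smul_mul_assoc, one_mul, smul_sub,
    smul_smul, inv_mul_cancel₀ hzw, one_smul]

theorem resolvent_commute (a : 𝔸) (z : ℂ) : Commute a (resolvent a z) := by
  have h : Commute a (algebraMap ℂ 𝔸 z - a) :=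
    (Algebra.commute_algebraMap_right z a).sub_right (Commute.refl a)
  by_cases hu : IsUnit (algebraMap ℂ 𝔸 z - a)
  · obtain ⟨u, hu⟩ := hu
    rw [resolvent, ← hu, Ring.inverse_unit]
    rw [← hu] at h
    exact h.units_inv_right
  · rw [resolvent, Ring.inverse_non_unit _ hu]
    exact Commute.zero_right a

theorem commute_circleIntegral {b : 𝔸} {f : ℂ → 𝔸} (hf : CircleIntegrable f c r)
    (h : ∀ z, Commute b (f z)) : Commute b (∮ z in C(c, r), f z) := by
  have h1 := (ContinuousLinearMap.mul ℂ 𝔸 b).map_circleIntegral hf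
  have h2 := ((ContinuousLinearMap.mul ℂ 𝔸).flip b).map_circleIntegral hf
  simp only [ContinuousLinearMap.mul_apply', ContinuousLinearMap.flip_apply] at h1 h2
  rw [Commute, SemiconjBy, h1, h2]
  congr 1
  ext z
  exact h z

theorem commute_contourProjection (hr : 0 ≤ r) (h : sphere c r ⊆ resolventSet ℂ a) :
    Commute a (contourProjection a c r) :=
  (commute_circleIntegral (circleIntegrable_resolvent hr h) (resolvent_commute a)).smul_right _

theorem commute_cauchyResolvent (hr : 0 ≤ r) (h : sphere c r ⊆ resolventSet ℂ a)
    {w : ℂ} (hw : w ∉ sphere c r) : Commute a (cauchyResolvent a c r w) :=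
  (commute_circleIntegral (circleIntegrable_inv_smul_resolvent hr h hw)
    fun z => (resolvent_commute a z).smul_right _).smul_right _

theorem not_mem_sphere_of_mem_ball {w : ℂ} (hw : w ∈ ball c r) : w ∉ sphere c r := by
  simp only [mem_ball, mem_sphere] at *; exact hw.ne

theorem not_mem_sphere_of_not_mem_closedBall {w : ℂ} (hw : w ∉ closedBall c r) :
    w ∉ sphere c r := fun h => hw (sphere_subset_closedBall h)

theorem sub_mul_cauchyResolvent_of_mem_ball (h : sphere c r ⊆ resolventSet ℂ a)
    {w : ℂ} (hw : w ∈ ball c r) :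
    (algebraMap ℂ 𝔸 w - a) * cauchyResolvent a c r w = 1 - contourProjection a c r := by
  have hr : 0 ≤ r := (dist_nonneg.trans_lt (mem_ball.1 hw)).le
  rw [sub_mul_cauchyResolvent hr h (not_mem_sphere_of_mem_ball hw),
    circleIntegral.integral_sub_inv_of_mem_ball hw, inv_mul_cancel₀ Complex.two_pi_I_ne_zero,
    one_smul]

theorem sub_mul_cauchyResolvent_of_not_mem_closedBall (hr : 0 ≤ r)
    (h : sphere c r ⊆ resolventSet ℂ a) {w : ℂ} (hw : w ∉ closedBall c r) :
    (algebraMap ℂ 𝔸 w - a) * cauchyResolvent a c r w = - contourProjection a c r := by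
  have : (∮ z in C(c, r), (z - w)⁻¹) = 0 := by
    refine Complex.circleIntegral_eq_zero_of_differentiable_on_off_countable hr
      Set.countable_empty (fun z hz => ?_) (fun z hz => ?_)
    · have : z - w ≠ 0 := fun h0 => hw (by rwa [← sub_eq_zero.1 h0])
      exact ContinuousAt.continuousWithinAt (by fun_prop (disch := assumption))
    · have : z - w ≠ 0 := fun h0 => hw (by
        rw [← sub_eq_zero.1 h0]; exact ball_subset_closedBall hz.1)
      fun_prop (disch := assumption)
  rw [sub_mul_cauchyResolvent hr h (not_mem_sphere_of_not_mem_closedBall hw), this]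
  simp

/-- The contour integral of the resolvent does not change when the circle is moved through the
resolvent set. -/
theorem contourProjection_eq_of_annulus {s : ℝ} (hs : 0 < s) (hsr : s ≤ r)
    (h : closedBall c r \ ball c s ⊆ resolventSet ℂ a) :
    contourProjection a c r = contourProjection a c s := by
  rw [contourProjection, contourProjection]
  congr 1
  refine Complex.circleIntegral_eq_of_differentiable_on_annulus_off_countable hs hsr
    Set.countable_empty ((continuousOn_resolvent a).mono h) fun z hz => ?_
  refine (spectrum.hasDerivAt_resolvent_const_left
    (h ⟨ball_subset_closedBall hz.1.1, fun h' => ?_⟩)).differentiableAt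
  exact hz.1.2 (ball_subset_closedBall h')

theorem circleIntegral_resolvent_eq_zero (hr : 0 ≤ r) (h : closedBall c r ⊆ resolventSet ℂ a) :
    (∮ z in C(c, r), resolvent a z) = 0 :=
  Complex.circleIntegral_eq_zero_of_differentiable_on_off_countable hr
    Set.countable_empty ((continuousOn_resolvent a).mono h)
    fun _ hz => (spectrum.hasDerivAt_resolvent_const_left (h (ball_subset_closedBall hz.1))).differentiableAt

theorem resolvent_mul_one_sub_contourProjection (h : sphere c r ⊆ resolventSet ℂ a)
    {w : ℂ} (hw : w ∈ ball c r) (hw' : w ∈ resolventSet ℂ a) :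
    resolvent a w * (1 - contourProjection a c r) = cauchyResolvent a c r w := by
  rw [← sub_mul_cauchyResolvent_of_mem_ball h hw, ← mul_assoc, resolvent_mul_sub hw', one_mul]

/-- A Cauchy integral is holomorphic in the disc whatever the spectrum of `a` inside; only
continuity of the resolvent on the circle matters. -/
theorem differentiableOn_cauchyResolvent (hr : 0 < r) (h : sphere c r ⊆ resolventSet ℂ a) :
    DifferentiableOn ℂ (cauchyResolvent a c r) (ball c r) := by
  lift r to NNReal using hr.le
  have := (hasFPowerSeriesOn_cauchy_integral (circleIntegrable_resolvent hr.le h)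
    (by exact_mod_cast hr)).differentiableOn
  rwa [Metric.eball_coe] at this

theorem exists_inner_annulus (hr : 0 < r) (h : sphere c r ⊆ resolventSet ℂ a) :
    ∃ s, 0 < s ∧ s < r ∧ closedBall c r \ ball c s ⊆ resolventSet ℂ a := by
  obtain ⟨δ, hδ, hsub⟩ := (isCompact_sphere c r).exists_thickening_subset_open
    (spectrum.isOpen_resolventSet a) h
  -- The term `r / 2` keeps the inner radius positive; `r - δ / 2` keeps the annulus within `δ` of
  -- the circle.
  refine ⟨max (r / 2) (r - δ / 2), by positivity, max_lt (by linarith) (by linarith), ?_⟩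
  rintro z ⟨hz, hz'⟩
  apply hsub
  simp only [mem_closedBall, mem_ball, not_lt, Complex.dist_eq] at hz hz'
  have h1 : 0 < ‖z - c‖ := lt_of_lt_of_le (by positivity) hz'
  have h2 : r - δ / 2 ≤ ‖z - c‖ := (le_max_right _ _).trans hz'
  have hn : (‖z - c‖ : ℂ) ≠ 0 := by exact_mod_cast h1.ne'
  rw [mem_thickening_iff]
  -- The radial projection of `z` onto the circle.
  refine ⟨c + ((r / ‖z - c‖ : ℝ) : ℂ) * (z - c), ?_, ?_⟩
  · rw [mem_sphere, Complex.dist_eq, add_sub_cancel_left, norm_mul, Complex.norm_real,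
      Real.norm_of_nonneg (by positivity)]
    field_simp
  · have : z - (c + ((r / ‖z - c‖ : ℝ) : ℂ) * (z - c))
        = (((‖z - c‖ - r) / ‖z - c‖ : ℝ) : ℂ) * (z - c) := by
      push_cast; field_simp; ring
    rw [Complex.dist_eq, this, norm_mul, Complex.norm_real, norm_div, norm_norm,
      div_mul_cancel₀ _ h1.ne', Real.norm_eq_abs, abs_lt]
    constructor <;> linarith

/-- Compute the left factor of `P (1 - P)` on a slightly smaller circle. There `R(w) (1 - P)` equals
the Cauchy transform, which is holomorphic inside the larger circle, so the integral vanishes. -/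
theorem isIdempotentElem_contourProjection (hr : 0 < r) (h : sphere c r ⊆ resolventSet ℂ a) :
    IsIdempotentElem (contourProjection a c r) := by
  obtain ⟨s, hs, hsr, hsub⟩ := exists_inner_annulus hr h
  have hS : sphere c s ⊆ resolventSet ℂ a := fun z hz =>
    hsub ⟨closedBall_subset_closedBall hsr.le (sphere_subset_closedBall hz),
      fun hz' => not_mem_sphere_of_mem_ball hz' hz⟩
  have hb : closedBall c s ⊆ ball c r := closedBall_subset_ball hsr
  have h1 : contourProjection a c r * (1 - contourProjection a c r) = 0 := by
    nth_rewrite 1 [contourProjection_eq_of_annulus hs hsr.le hsub]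
    have h2 := ((ContinuousLinearMap.mul ℂ 𝔸).flip
      (1 - contourProjection a c r)).map_circleIntegral (circleIntegrable_resolvent hs.le hS)
    simp only [ContinuousLinearMap.mul_apply', ContinuousLinearMap.flip_apply] at h2
    rw [contourProjection, smul_mul_assoc, h2, circleIntegral.integral_congr hs.le
      (g := cauchyResolvent a c r) fun z hz => resolvent_mul_one_sub_contourProjection h
        (hb (sphere_subset_closedBall hz)) (hS hz)]
    have hd := differentiableOn_cauchyResolvent hr h
    rw [Complex.circleIntegral_eq_zero_of_differentiable_on_off_countable hs.le
      Set.countable_empty (hd.continuousOn.mono hb) fun z hz =>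
        hd.differentiableAt (isOpen_ball.mem_nhds (hb (ball_subset_closedBall hz.1))), smul_zero]
  rw [mul_sub, mul_one, sub_eq_zero] at h1
  exact h1.symm

theorem continuous_algebraMap_sub :
    Continuous fun p : 𝔸 × ℂ => algebraMap ℂ 𝔸 p.2 - p.1 :=
  ((algebraMapCLM ℂ 𝔸).continuous.comp continuous_snd).sub continuous_fst

theorem eventually_subset_resolventSet {S : Set ℂ} (hS : IsCompact S)
    (h : S ⊆ resolventSet ℂ a) : ∀ᶠ b in 𝓝 a, S ⊆ resolventSet ℂ b :=
  hS.eventually_forall_of_forall_eventually (P := fun b z => z ∈ resolventSet ℂ b) fun z hz =>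
    (continuous_algebraMap_sub (𝔸 := 𝔸)).continuousAt.preimage_mem_nhds
      (Units.isOpen.mem_nhds (show (algebraMap ℂ 𝔸 z - a) ∈ {x : 𝔸 | IsUnit x} from h hz))

/-- The contour integral of the resolvent depends continuously on the element. -/
theorem continuousAt_contourProjection (hr : 0 < r) (h : sphere c r ⊆ resolventSet ℂ a) :
    ContinuousAt (fun b : 𝔸 => contourProjection b c r) a := by
  refine Tendsto.const_smul ?_ _
  refine TendstoUniformlyOn.tendsto_circleIntegral_of_continuousOn hr.le ?_ ?_
  · filter_upwards [eventually_subset_resolventSet (isCompact_sphere c r) h] with b hb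
    exact (continuousOn_resolvent b).mono hb
  · rw [Metric.tendstoUniformlyOn_iff]
    intro ε hε
    -- Joint continuity of the resolvent in the element and the point becomes uniform convergence by
    -- compactness of the circle.
    refine (isCompact_sphere c r).eventually_forall_of_forall_eventually
      (P := fun b z => dist (resolvent a z) (resolvent b z) < ε) fun z hz => ?_
    obtain ⟨u, hu⟩ := h hz
    have h1 : ContinuousAt (fun p : 𝔸 × ℂ => resolvent p.1 p.2) (a, z) := by
      have := NormedRing.inverse_continuousAt u
      rw [hu] at this
      exact ContinuousAt.comp (f := fun p : 𝔸 × ℂ => algebraMap ℂ 𝔸 p.2 - p.1) this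
        (continuous_algebraMap_sub (𝔸 := 𝔸)).continuousAt
    have h2 : ContinuousAt (fun p : 𝔸 × ℂ => resolvent a p.2) (a, z) :=
      ContinuousAt.comp (f := fun p : 𝔸 × ℂ => p.2) (g := resolvent a)
        (spectrum.hasDerivAt_resolvent_const_left (h hz)).continuousAt continuousAt_snd
    have h3 := h2.dist h1
    exact h3.eventually_lt_const (by simpa using hε)

end RieszBanach

/-! ### Riesz projections of operators and generalized eigenspaces. -/

section RieszOperator

variable {K : Type*} [NormedAddCommGroup K] [InnerProductSpace ℂ K] [CompleteSpace K]

theorem rieszIntegral_eq_contourProjection (A : K →L[ℂ] K) (z : ℂ) (r : ℝ) :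
    rieszIntegral A z r = contourProjection A z r := rfl

/-- The generalized eigenspace of a bounded operator at a complex number. -/
def genSpace (H : K →L[ℂ] K) (z : ℂ) : Submodule ℂ K :=
  Module.End.maxGenEigenspace (H : K →ₗ[ℂ] K) z

/-- The range of the contour integral of the resolvent. -/
def contourSpace (H : K →L[ℂ] K) (c : ℂ) (r : ℝ) : Submodule ℂ K :=
  ((contourProjection H c r : K →L[ℂ] K) : K →ₗ[ℂ] K).range

variable {H B : K →L[ℂ] K} {c z : ℂ} {r : ℝ}

theorem mem_genSpace_iff {v : K} :
    v ∈ genSpace H z ↔ ∃ n : ℕ, ((algebraMap ℂ (K →L[ℂ] K) z - H) ^ n) v = 0 := by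
  have key : ∀ n : ℕ, (((H : K →ₗ[ℂ] K) - z • (1 : Module.End ℂ K)) ^ n) v =
      (-1 : ℂ) ^ n • ((algebraMap ℂ (K →L[ℂ] K) z - H) ^ n) v := by
    intro n
    have e : (((H : K →ₗ[ℂ] K) - z • (1 : Module.End ℂ K))) =
      ((-1 : ℂ) • (algebraMap ℂ (K →L[ℂ] K) z - H) : K →L[ℂ] K) := by
      ext x; simp [Algebra.algebraMap_eq_smul_one]
    rw [e, ← ContinuousLinearMap.toLinearMap_pow, smul_pow]
    rfl
  rw [genSpace, Module.End.mem_maxGenEigenspace]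
  refine exists_congr fun n => ?_
  rw [key, smul_eq_zero_iff_right (pow_ne_zero _ (by norm_num))]

theorem genSpace_eq_bot_of_mem_resolventSet (hz : z ∈ resolventSet ℂ H) : genSpace H z = ⊥ := by
  refine eq_bot_iff.2 fun v hv => ?_
  obtain ⟨n, hn⟩ := mem_genSpace_iff.1 hv
  have h1 : resolvent H z ^ n * (algebraMap ℂ (K →L[ℂ] K) z - H) ^ n = 1 := by
    rw [← Commute.mul_pow, resolvent_mul_sub hz, one_pow]
    rw [Commute, SemiconjBy, resolvent_mul_sub hz, sub_mul_resolvent hz]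
  have := congrArg (fun T : K →L[ℂ] K => T v) h1
  simpa [hn] using this.symm

theorem mem_range_iff_of_isIdempotentElem {P : K →L[ℂ] K} (hP : IsIdempotentElem P) {v : K} :
    v ∈ (P : K →ₗ[ℂ] K).range ↔ P v = v := by
  constructor
  · rintro ⟨w, rfl⟩
    exact congrArg (fun T : K →L[ℂ] K => T w) hP
  · intro h
    exact ⟨v, h⟩

theorem commute_algebraMap_sub_cauchyResolvent (hr : 0 ≤ r) (h : sphere c r ⊆ resolventSet ℂ H)
    (hw : z ∉ sphere c r) :
    Commute (algebraMap ℂ (K →L[ℂ] K) z - H) (cauchyResolvent H c r z) :=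
  (Algebra.commute_algebraMap_left z _).sub_left (commute_cauchyResolvent hr h hw)

theorem mem_contourSpace_iff (hr : 0 < r) (h : sphere c r ⊆ resolventSet ℂ H) {v : K} :
    v ∈ contourSpace H c r ↔ contourProjection H c r v = v :=
  mem_range_iff_of_isIdempotentElem (isIdempotentElem_contourProjection hr h)

/-- On the kernel of the Riesz projection, `z - H` is surjective, with all its powers. -/
theorem one_sub_contourProjection_eq (hr : 0 < r) (h : sphere c r ⊆ resolventSet ℂ H)
    (hz : z ∈ ball c r) (n : ℕ) :
    1 - contourProjection H c r =
      (algebraMap ℂ (K →L[ℂ] K) z - H) ^ n * (cauchyResolvent H c r z ^ n *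
        (1 - contourProjection H c r)) := by
  have hi := (isIdempotentElem_contourProjection hr h).one_sub
  rw [← mul_assoc, ← (commute_algebraMap_sub_cauchyResolvent hr.le h
    (not_mem_sphere_of_mem_ball hz)).mul_pow, sub_mul_cauchyResolvent_of_mem_ball h hz,
    ← pow_succ, hi.pow_succ_eq]

/-- The factor `(z - H) ^ n` of `1 - P` can be commuted to the right, where it annihilates the
generalized eigenvector. -/
theorem genSpace_le_range_contourProjection (hr : 0 < r) (h : sphere c r ⊆ resolventSet ℂ H)
    (hz : z ∈ ball c r) :
    genSpace H z ≤ contourSpace H c r := by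
  intro v hv
  obtain ⟨n, hn⟩ := mem_genSpace_iff.1 hv
  rw [mem_contourSpace_iff hr h]
  have e := one_sub_contourProjection_eq hr h hz n
  have hc := commute_algebraMap_sub_cauchyResolvent hr.le h (not_mem_sphere_of_mem_ball hz)
  have hc2 : Commute (algebraMap ℂ (K →L[ℂ] K) z - H) (1 - contourProjection H c r) := by
    rw [← sub_mul_cauchyResolvent_of_mem_ball h hz]
    exact (Commute.refl _).mul_right hc
  rw [((hc.pow_right n).mul_right hc2).pow_left n |>.eq] at e
  have := congrArg (fun T : K →L[ℂ] K => T v) e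
  simp only [mul_apply_eq_comp, hn, map_zero] at this
  exact (sub_eq_zero.1 this).symm

theorem range_contourProjection_invariant (hr : 0 < r) (h : sphere c r ⊆ resolventSet ℂ H)
    {v : K} (hv : v ∈ contourSpace H c r) :
    H v ∈ contourSpace H c r := by
  rw [mem_contourSpace_iff hr h] at hv ⊢
  have := congrArg (fun T : K →L[ℂ] K => T v) (commute_contourProjection hr.le h).eq
  simp only [mul_apply_eq_comp, hv] at this
  exact this.symm

/-- Outside the closed disc the Cauchy transform `C` satisfies `C (z - H) = -P`, so `z - H` and its
powers are injective on the range of `P`. On the circle itself the generalized eigenspace is already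
trivial. -/
theorem disjoint_genSpace_range_contourProjection (hr : 0 < r)
    (h : sphere c r ⊆ resolventSet ℂ H) (hz : z ∉ ball c r) :
    contourSpace H c r ⊓ genSpace H z = ⊥ := by
  by_cases hs : z ∈ sphere c r
  · rw [genSpace_eq_bot_of_mem_resolventSet (h hs), inf_bot_eq]
  have hz' : z ∉ closedBall c r := by
    rw [← ball_union_sphere]; exact fun h' => h'.elim hz hs
  refine eq_bot_iff.2 fun v hv => ?_
  obtain ⟨hv1, hv2⟩ := hv
  obtain ⟨n, hn⟩ := mem_genSpace_iff.1 hv2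
  have hvP := (mem_contourSpace_iff hr h).1 hv1
  have hc := commute_algebraMap_sub_cauchyResolvent hr.le h hs
  have e : cauchyResolvent H c r z ^ n * (algebraMap ℂ (K →L[ℂ] K) z - H) ^ n =
      (- contourProjection H c r) ^ n := by
    rw [← hc.symm.mul_pow, ← hc.eq, sub_mul_cauchyResolvent_of_not_mem_closedBall hr.le h hz']
  have e2 : ∀ m : ℕ, ((- contourProjection H c r) ^ m) v = (-1 : ℂ) ^ m • v := by
    intro m
    induction m with
    | zero => simp
    | succ m ih => rw [pow_succ, mul_apply_eq_comp, neg_apply, hvP,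
        map_neg, ih, pow_succ]; simp
  have := congrArg (fun T : K →L[ℂ] K => T v) e
  simp only [mul_apply_eq_comp, hn, map_zero, e2] at this
  exact (smul_eq_zero_iff_right (pow_ne_zero n (by norm_num))).1 this.symm

/-- If it is finite dimensional, the range of the Riesz projection is the sum of the generalized
eigenspaces at the points inside the contour. -/
theorem range_contourProjection_eq_iSup (hr : 0 < r) (h : sphere c r ⊆ resolventSet ℂ H)
    (hfin : FiniteDimensional ℂ (contourSpace H c r)) :
    contourSpace H c r = ⨆ z ∈ ball c r, genSpace H z := by
  refine le_antisymm ?_ (iSup₂_le fun z hz => genSpace_le_range_contourProjection hr h hz)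
  set p := contourSpace H c r with hp
  have hinv : ∀ x ∈ p, (H : K →ₗ[ℂ] K) x ∈ p := fun x hx =>
    range_contourProjection_invariant hr h hx
  -- On a finite dimensional complex space the generalized eigenspaces span; those at points outside
  -- the open disc contribute nothing.
  have h1 := Module.End.iSup_maxGenEigenspace_eq_top (LinearMap.restrict (H : K →ₗ[ℂ] K) hinv)
  have h2 := congrArg (Submodule.map p.subtype) h1
  rw [Submodule.map_iSup, Submodule.map_top, Submodule.range_subtype] at h2
  rw [← h2]
  refine iSup_le fun z => ?_
  have h3 := Submodule.inf_genEigenspace (H : K →ₗ[ℂ] K) p (k := ⊤) (μ := z) hinv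
  change p ⊓ genSpace H z = _ at h3
  rw [Module.End.maxGenEigenspace, ← h3]
  by_cases hz : z ∈ ball c r
  · exact inf_le_right.trans (le_iSup₂_of_le z hz le_rfl)
  · rw [hp, disjoint_genSpace_range_contourProjection hr h hz]
    exact bot_le

/-- The range is closed, being the fixed point set of `P`, and `P` restricts to the identity there;
a space with compact identity is locally compact, hence finite dimensional. -/
theorem finiteDimensional_range_of_isCompactOperator {P : K →L[ℂ] K} (hP : IsIdempotentElem P)
    (hc : IsCompactOperator P) : FiniteDimensional ℂ (P : K →ₗ[ℂ] K).range := by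
  have hcl : IsClosed ((P : K →ₗ[ℂ] K).range : Set K) := by
    have : ((P : K →ₗ[ℂ] K).range : Set K) = {v | P v = v} :=
      Set.ext fun v => mem_range_iff_of_isIdempotentElem hP
    rw [this]
    exact isClosed_eq P.continuous continuous_id
  have h1 := (hc.codRestrict (V := (P : K →ₗ[ℂ] K).range) (fun x => ⟨x, rfl⟩) hcl).comp_clm
    (P : K →ₗ[ℂ] K).range.subtypeL
  have h2 : IsCompactOperator (id : (P : K →ₗ[ℂ] K).range → (P : K →ₗ[ℂ] K).range) := by
    refine cast (congrArg IsCompactOperator ?_) h1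
    ext v
    exact ((mem_range_iff_of_isIdempotentElem hP).1 v.2)
  have := LocallyCompactSpace.of_isCompactOperator_id h2
  exact FiniteDimensional.of_locallyCompactSpace ℂ

/-- Pass to the quotient by `V`, where the integrand is zero on the circle. -/
theorem circleIntegral_mem_of_isClosed {E : Type*} [NormedAddCommGroup E] [NormedSpace ℂ E]
    [CompleteSpace E] (V : Submodule ℂ E) (hV : IsClosed (V : Set E)) {f : ℂ → E}
    (hr : 0 ≤ r) (hf : CircleIntegrable f c r) (hfV : ∀ z ∈ sphere c r, f z ∈ V) :
    (∮ z in C(c, r), f z) ∈ V := by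
  have : IsClosed (V : Set E) := hV
  have h := V.mkQL.map_circleIntegral hf
  have h1 : (∮ z in C(c, r), V.mkQL (f z)) = ∮ _ in C(c, r), (0 : E ⧸ V) :=
    circleIntegral.integral_congr hr fun z hz => by simpa using hfV z hz
  have h0 : (∮ _ in C(c, r), (0 : E ⧸ V)) = 0 := by simp [circleIntegral]
  rw [h1, h0] at h
  simpa using h

/-- If `H` is a compact perturbation of an operator with no spectrum inside the contour, then the
Riesz projection of `H` has finite rank. -/
theorem finiteDimensional_range_contourProjection (hr : 0 < r)
    (h : sphere c r ⊆ resolventSet ℂ H) (hB : closedBall c r ⊆ resolventSet ℂ B)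
    (hF : IsCompactOperator (B - H)) :
    FiniteDimensional ℂ (contourSpace H c r) := by
  have hB' : sphere c r ⊆ resolventSet ℂ B := sphere_subset_closedBall.trans hB
  refine finiteDimensional_range_of_isCompactOperator (isIdempotentElem_contourProjection hr h) ?_
  suffices contourProjection H c r ∈ compactOperator (RingHom.id ℂ) K K from this
  refine Submodule.smul_mem _ _ ?_
  have iH := circleIntegrable_resolvent hr.le h
  have iB := circleIntegrable_resolvent hr.le hB'
  -- The resolvent of `B` integrates to zero, and by the second resolvent identity the difference of
  -- resolvents is compact.
  have e : (∮ z in C(c, r), resolvent H z) = ∮ z in C(c, r), (resolvent H z - resolvent B z) := by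
    rw [circleIntegral.integral_sub iH iB, circleIntegral_resolvent_eq_zero hr.le hB, sub_zero]
  rw [e]
  refine circleIntegral_mem_of_isClosed _ isClosed_setOfPred_isCompactOperator hr.le (iH.sub iB)
    fun z hz => ?_
  have e2 : resolvent H z - resolvent B z = - (resolvent B z * (B - H) * resolvent H z) := by
    have : B - H = (algebraMap ℂ (K →L[ℂ] K) z - H) - (algebraMap ℂ (K →L[ℂ] K) z - B) := by abel
    rw [this, mul_sub, resolvent_mul_sub (hB' hz), sub_mul, one_mul, mul_assoc,
      sub_mul_resolvent (h hz), mul_one, neg_sub]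
  rw [e2]
  refine Submodule.neg_mem _ ?_
  exact (hF.clm_comp (resolvent B z)).comp_clm (resolvent H z)

/-- The chosen separating circle may leave the region where `B` is known to have no spectrum. It can
be shrunk without crossing the spectrum of `H`, and then `z` is the only point inside that
contributes. -/
theorem rieszSpace_eq_genSpace (hs : ∃ s, IsSeparatingRadius H z s) (hB : z ∈ resolventSet ℂ B)
    (hF : IsCompactOperator (B - H)) :
    rieszSpace H z = genSpace H z ∧ FiniteDimensional ℂ (rieszSpace H z) := by
  obtain ⟨hpos, hsep⟩ := hs.choose_spec
  have e : rieszSpace H z = contourSpace H z hs.choose := by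
    rw [rieszSpace, rieszProjection, dif_pos hs, rieszIntegral_eq_contourProjection, contourSpace]
  set s := hs.choose
  obtain ⟨ε, hε, hεB⟩ := Metric.isOpen_iff.1 (spectrum.isOpen_resolventSet B) z hB
  have ht0 : 0 < min s (ε / 2) := lt_min hpos (by positivity)
  have hρ : ∀ w ∈ closedBall z s, w ≠ z → w ∈ resolventSet ℂ H := fun w hw hne => by
    by_contra hw'
    exact hne (hsep ⟨hw', hw⟩)
  have hsph : sphere z (min s (ε / 2)) ⊆ resolventSet ℂ H := fun w hw =>
    hρ w (closedBall_subset_closedBall (min_le_left _ _) (sphere_subset_closedBall hw))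
      (ne_of_mem_sphere hw ht0.ne')
  have e2 : contourProjection H z s = contourProjection H z (min s (ε / 2)) := by
    refine contourProjection_eq_of_annulus ht0 (min_le_left _ _) fun w hw => hρ w hw.1 ?_
    rintro rfl
    exact hw.2 (mem_ball_self ht0)
  have hfin := finiteDimensional_range_contourProjection ht0 hsph
    (fun w hw => hεB (closedBall_subset_ball ((min_le_right _ _).trans_lt (by linarith)) hw)) hF
  rw [e, contourSpace, e2, ← contourSpace]
  refine ⟨?_, hfin⟩
  rw [range_contourProjection_eq_iSup ht0 hsph hfin]
  refine le_antisymm (iSup₂_le fun w hw => ?_) (le_iSup₂_of_le z (mem_ball_self ht0) le_rfl)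
  by_cases hwz : w = z
  · rw [hwz]
  · rw [genSpace_eq_bot_of_mem_resolventSet (hρ w (closedBall_subset_closedBall (min_le_left _ _)
      (ball_subset_closedBall hw)) hwz)]
    exact bot_le

end RieszOperator

/-! ### Perturbation determinants and isolation of the spectrum. -/

section FiniteRankPerturbation

variable {K : Type*} [NormedAddCommGroup K] [InnerProductSpace ℂ K] [CompleteSpace K]
  {V : Type*} [NormedAddCommGroup V] [NormedSpace ℂ V] [FiniteDimensional ℂ V]

/-- The perturbation determinant `det (1 + Ψ (z - B)⁻¹ Φ)` of the finite rank perturbation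
`B - ΦΨ` of `B`. -/
def perturbationDet (B : K →L[ℂ] K) (Φ : V →L[ℂ] K) (Ψ : K →L[ℂ] V) (z : ℂ) : ℂ :=
  LinearMap.det ((1 + Ψ ∘L resolvent B z ∘L Φ : V →L[ℂ] V) : V →ₗ[ℂ] V)

variable {H B : K →L[ℂ] K} {Φ : V →L[ℂ] K} {Ψ : K →L[ℂ] V} {z : ℂ}

/-- Since `z - H = (z - B) + ΦΨ`, solving `(z - H) x = y` reduces to a finite dimensional equation
for `N = 1 + ΨRΦ`: if `N v = ΨRy`, then `x = R (y - Φv)`. Conversely, if `N v = 0`, then `RΦv` lies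
in the kernel of `z - H`. -/
theorem perturbationDet_ne_zero_iff (hB : z ∈ resolventSet ℂ B) (hH : B = H + Φ ∘L Ψ) :
    perturbationDet B Φ Ψ z ≠ 0 ↔ z ∈ resolventSet ℂ H := by
  set R := resolvent B z with hR
  have r1 : ∀ x, z • R x - B (R x) = x := fun x => by
    simpa [Algebra.algebraMap_eq_smul_one] using
      congrArg (fun T : K →L[ℂ] K => T x) (sub_mul_resolvent hB)
  have r2 : ∀ x, R (z • x - B x) = x := fun x => by
    simpa [Algebra.algebraMap_eq_smul_one] using
      congrArg (fun T : K →L[ℂ] K => T x) (resolvent_mul_sub hB)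
  have hHx : ∀ x, (algebraMap ℂ (K →L[ℂ] K) z - H) x = z • x - B x + Φ (Ψ x) := fun x => by
    rw [hH]; simp [Algebra.algebraMap_eq_smul_one]; abel
  have hN : ∀ v, ((1 + Ψ ∘L R ∘L Φ : V →L[ℂ] V) : V →ₗ[ℂ] V) v = v + Ψ (R (Φ v)) :=
    fun v => rfl
  rw [perturbationDet, ← isUnit_iff_ne_zero, ← LinearMap.isUnit_iff_isUnit_det,
    spectrum.mem_resolventSet_iff, ContinuousLinearMap.isUnit_iff_bijective, ← hR]
  constructor
  · intro hu
    have hbij := (Module.End.isUnit_iff _).1 hu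
    constructor
    · rw [injective_iff_map_eq_zero]
      intro x hx
      rw [hHx] at hx
      have h1 : Ψ x = 0 := by
        apply hbij.1
        rw [hN, map_zero]
        have := congrArg (fun y => Ψ (R y)) hx
        simpa [map_add, r2, -map_sub] using this
      rw [h1, map_zero, add_zero] at hx
      rw [← r2 x, hx, map_zero]
    · intro y
      obtain ⟨v, hv⟩ := hbij.2 (Ψ (R y))
      rw [hN] at hv
      refine ⟨R (y - Φ v), ?_⟩
      rw [hHx, r1, map_sub, map_sub, ← hv]
      simp
  · intro hb
    rw [LinearMap.isUnit_iff_ker_eq_bot, LinearMap.ker_eq_bot']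
    intro v hv
    rw [hN] at hv
    have h1 : R (Φ v) = 0 := by
      apply hb.1
      rw [hHx, r1, map_zero, ← map_add, hv, map_zero]
    rwa [h1, map_zero, add_zero] at hv

/-- In the Leibniz expansion each matrix entry is a constant plus a continuous linear functional of
the holomorphic resolvent. -/
theorem differentiableOn_perturbationDet (B : K →L[ℂ] K) (Φ : V →L[ℂ] K) (Ψ : K →L[ℂ] V) :
    DifferentiableOn ℂ (perturbationDet B Φ Ψ) (resolventSet ℂ B) := by
  have b := Module.finBasis ℂ V
  have e : perturbationDet B Φ Ψ = fun z => ∑ σ : Equiv.Perm (Fin (Module.finrank ℂ V)),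
      Equiv.Perm.sign σ • ∏ i, b.coord (σ i) (b i + Ψ (resolvent B z (Φ (b i)))) := by
    ext z
    rw [perturbationDet, ← LinearMap.det_toMatrix b, Matrix.det_apply]
    simp only [LinearMap.toMatrix_apply]
    rfl
  rw [e]
  refine DifferentiableOn.fun_sum fun σ _ => ?_
  refine DifferentiableOn.const_smul (DifferentiableOn.fun_finsetProd fun i _ => ?_) _
  let L : (K →L[ℂ] K) →L[ℂ] ℂ := (LinearMap.toContinuousLinearMap (b.coord (σ i))) ∘L Ψ ∘L
    (ContinuousLinearMap.apply ℂ K (Φ (b i)))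
  have h1 : (fun z : ℂ => b.coord (σ i) (b i + Ψ (resolvent B z (Φ (b i))))) =
      fun z : ℂ => b.coord (σ i) (b i) + L (resolvent B z) := by
    ext z
    rw [map_add]
    rfl
  refine DifferentiableOn.congr ?_ fun w _ => congrFun h1 w
  have hd : DifferentiableOn ℂ (fun w : ℂ => L (resolvent B w)) (resolventSet ℂ B) :=
    L.differentiable.comp_differentiableOn (differentiableOn_resolvent B)
  exact (differentiableOn_const _).add hd

/-- An analytic function either vanishes near a point or has no zeros in a punctured neighbourhood.
-/
theorem eventually_mem_spectrum_or_resolventSet (hB : z ∈ resolventSet ℂ B)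
    (hH : B = H + Φ ∘L Ψ) :
    (∀ᶠ w in 𝓝 z, w ∈ spectrum ℂ H) ∨ ∀ᶠ w in 𝓝[≠] z, w ∈ resolventSet ℂ H := by
  have hnhds := (spectrum.isOpen_resolventSet B).mem_nhds hB
  have ha := (differentiableOn_perturbationDet B Φ Ψ).analyticAt hnhds
  rcases ha.eventually_eq_zero_or_eventually_ne_zero with h | h
  · left
    filter_upwards [h, hnhds] with w hw hwB
    exact fun hw' => (perturbationDet_ne_zero_iff hwB hH).2 hw' hw
  · right
    filter_upwards [h, mem_nhdsWithin_of_mem_nhds hnhds] with w hw hwB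
    exact (perturbationDet_ne_zero_iff hwB hH).1 hw

end FiniteRankPerturbation

/-! ### The real spectrum of a `J`-hermitian `ℝ`-Fredholm operator. -/

section JHermitian

variable {K : Type*} [NormedAddCommGroup K] [InnerProductSpace ℂ K] [CompleteSpace K]
  {J H : K →L[ℂ] K}

theorem IsFundamentalSymmetry.apply_apply (hJ : IsFundamentalSymmetry J) (x : K) :
    J (J x) = x := by
  have h := (Unitary.mem_iff.1 hJ.mem_unitary).1
  rw [hJ.isSelfAdjoint.star_eq] at h
  exact congrArg (fun T : K →L[ℂ] K => T x) h

theorem IsFundamentalSymmetry.inner_left (hJ : IsFundamentalSymmetry J) (x y : K) :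
    ⟪J x, y⟫_ℂ = ⟪x, J y⟫_ℂ := by
  rw [← ContinuousLinearMap.adjoint_inner_right]
  exact congrArg (fun T : K →L[ℂ] K => ⟪x, T y⟫_ℂ) hJ.isSelfAdjoint.star_eq

theorem IsJHermitian.inner_apply (hH : IsJHermitian J H) (x y : K) :
    ⟪H x, J y⟫_ℂ = ⟪x, J (H y)⟫_ℂ := by
  rw [← ContinuousLinearMap.adjoint_inner_right]
  exact congrArg (fun T : K →L[ℂ] K => ⟪x, T y⟫_ℂ) hH

/-- A selfadjoint operator with closed range becomes invertible after adding the orthogonal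
projection onto its kernel. -/
theorem isUnit_add_starProjection_ker {A : K →L[ℂ] K} (hA : IsSelfAdjoint A)
    (hcl : IsClosed (A.range : Set K)) [A.ker.HasOrthogonalProjection] :
    IsUnit (A + A.ker.starProjection) := by
  have hrange : A.kerᗮ = A.range := by
    rw [ContinuousLinearMap.orthogonal_ker, ← ContinuousLinearMap.star_eq_adjoint, hA.star_eq]
    exact hcl.submodule_topologicalClosure_eq
  rw [ContinuousLinearMap.isUnit_iff_bijective]
  constructor
  · rw [injective_iff_map_eq_zero]
    intro x hx
    rw [add_apply] at hx
    have h1 : A x ∈ A.kerᗮ := by rw [hrange]; exact ⟨x, rfl⟩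
    have h2 : A.ker.starProjection x ∈ A.ker := A.ker.starProjection_apply_mem x
    have h3 : A.ker.starProjection x = 0 := by
      refine Submodule.disjoint_def.1 A.ker.orthogonal_disjoint _ h2 ?_
      rw [eq_neg_of_add_eq_zero_right hx]
      exact Submodule.neg_mem _ h1
    rw [h3, add_zero] at hx
    rw [← h3]
    exact (Submodule.starProjection_eq_self_iff.2 (show x ∈ A.ker from hx)).symm
  · intro y
    obtain ⟨x, hx⟩ : y - A.ker.starProjection y ∈ A.range := by
      rw [← hrange]; exact A.ker.sub_starProjection_mem_orthogonal y
    have hx : A x = y - A.ker.starProjection y := hx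
    have k : ∀ w, A (A.ker.starProjection w) = 0 := fun w => A.ker.starProjection_apply_mem w
    have i : ∀ w, A.ker.starProjection (A.ker.starProjection w) = A.ker.starProjection w :=
      fun w => Submodule.starProjection_eq_self_iff.2 (A.ker.starProjection_apply_mem w)
    refine ⟨x - A.ker.starProjection x + A.ker.starProjection y, ?_⟩
    rw [add_apply, map_add, map_add, map_sub, map_sub, k, k, i, i, hx]
    abel

/-- A `J`-hermitian operator whose shift by the real number `x` is Fredholm is a finite rank
perturbation of an operator with `x` in its resolvent set. -/
theorem exists_finiteRank_perturbation (hJ : IsFundamentalSymmetry J)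
    (hH : H ∈ fredholmJHermitian J) (x : ℝ) :
    ∃ (V : Submodule ℂ K) (_ : FiniteDimensional ℂ V) (Φ : V →L[ℂ] K) (Ψ : K →L[ℂ] V),
      (x : ℂ) ∈ resolventSet ℂ (H + Φ ∘L Ψ) ∧ (∀ v ∈ V, H v = (x : ℂ) • v) := by
  obtain ⟨hherm, hfred⟩ := hH
  set T := H - (x : ℂ) • ContinuousLinearMap.id ℂ K with hT
  have hTx : IsJHermitian J T := by
    rw [IsJHermitian] at hherm ⊢
    ext v
    refine ext_inner_left ℂ fun w => ?_
    have h1 := congrArg (fun S : K →L[ℂ] K => ⟪w, S v⟫_ℂ) hherm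
    simp only [ContinuousLinearMap.comp_apply] at h1 ⊢
    rw [ContinuousLinearMap.adjoint_inner_right] at h1 ⊢
    simp only [hT, sub_apply, smul_apply, ContinuousLinearMap.id_apply, inner_sub_left,
      inner_sub_right, inner_smul_left, inner_smul_right, map_sub, map_smul, h1,
      Complex.conj_ofReal]
  -- Composing with `J` turns `T` into a selfadjoint operator; as `J` is its own inverse, the kernel
  -- and the closedness of the range are preserved.
  set A := J ∘L T with hAdef
  have hAx : ∀ v, A v = J (T v) := fun v => rfl
  have hA : IsSelfAdjoint A := by
    rw [ContinuousLinearMap.isSelfAdjoint_iff_isSymmetric]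
    intro v w
    change ⟪J (T v), w⟫_ℂ = ⟪v, J (T w)⟫_ℂ
    rw [hJ.inner_left, hTx.inner_apply]
  have hker : A.ker = T.ker := by
    ext v
    change J (T v) = 0 ↔ T v = 0
    exact ⟨fun h => by rw [← hJ.apply_apply (T v), h, map_zero], fun h => by rw [h, map_zero]⟩
  have hfin : FiniteDimensional ℂ A.ker := by rw [hker]; exact (hfred x).finite_ker
  have hcl : IsClosed (A.range : Set K) := by
    have : (A.range : Set K) = J ⁻¹' (T.range : Set K) := by
      ext v
      constructor
      · rintro ⟨w, rfl⟩
        exact ⟨w, (hJ.apply_apply (T w)).symm⟩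
      · rintro ⟨w, hw⟩
        refine ⟨w, ?_⟩
        change J (T w) = v
        rw [show T w = J v from hw, hJ.apply_apply]
    rw [this]
    exact (hfred x).isClosed_range.preimage J.continuous
  have hu := isUnit_add_starProjection_ker hA hcl
  -- With `Π` the projection onto `A.ker`, the perturbation is `JΠ`. Since `J A = T`, it gives `x -
  -- (H + JΠ) = -J (A + Π)`, which is invertible.
  refine ⟨A.ker, hfin, J ∘L A.ker.subtypeL, A.ker.orthogonalProjectionOnto, ?_, ?_⟩
  · rw [spectrum.mem_resolventSet_iff]
    have hJu : IsUnit J := by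
      have : J * J = 1 := ContinuousLinearMap.ext hJ.apply_apply
      exact ⟨⟨J, J, this, this⟩, rfl⟩
    have e : algebraMap ℂ (K →L[ℂ] K) (x : ℂ) -
        (H + (J ∘L A.ker.subtypeL) ∘L A.ker.orthogonalProjectionOnto) =
        -(J * (A + A.ker.starProjection)) := by
      ext v
      have h1 : J (A v) = T v := by rw [hAx, hJ.apply_apply]
      simp only [sub_apply, add_apply, neg_apply, mul_apply_eq_comp, map_add, h1]
      simp only [hT, Algebra.algebraMap_eq_smul_one, sub_apply, smul_apply, one_apply_eq_self,
        ContinuousLinearMap.comp_apply, Submodule.subtypeL_apply, Submodule.starProjection_apply,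
        ContinuousLinearMap.id_apply]
      abel
    rw [e]
    exact (hJu.mul hu).neg
  · intro v hv
    rw [hker] at hv
    have : T v = 0 := hv
    simpa [hT, sub_eq_zero] using this

theorem exists_compact_perturbation (hJ : IsFundamentalSymmetry J)
    (hH : H ∈ fredholmJHermitian J) (x : ℝ) :
    ∃ B : K →L[ℂ] K, (x : ℂ) ∈ resolventSet ℂ B ∧ IsCompactOperator (B - H) := by
  obtain ⟨V, hV, Φ, Ψ, h, -⟩ := exists_finiteRank_perturbation hJ hH x
  refine ⟨_, h, ?_⟩
  rw [add_sub_cancel_left]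
  have : ProperSpace V := FiniteDimensional.proper ℂ V
  exact (isCompactOperator_of_locallyCompactSpace_rng Φ).comp_clm Ψ

theorem mem_resolventSet_of_norm_lt_norm {A : K →L[ℂ] K} {z : ℂ} (h : ‖A‖ < ‖z‖) :
    z ∈ resolventSet ℂ A := by
  refine spectrum.mem_resolventSet_of_norm_lt_mul (lt_of_le_of_lt ?_ h)
  exact mul_le_of_le_one_right (norm_nonneg _) ContinuousLinearMap.norm_id_le

/-- The set `S` of good real points is open, and closed by the dichotomy: near a bad point the
spectrum has interior, so neighbouring points are bad too. It contains `‖H‖ + 1`, and the line is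
connected. -/
theorem eventually_mem_resolventSet (hJ : IsFundamentalSymmetry J)
    (hH : H ∈ fredholmJHermitian J) (x : ℝ) :
    ∀ᶠ w in 𝓝[≠] (x : ℂ), w ∈ resolventSet ℂ H := by
  let S : Set ℝ := {x : ℝ | ∀ᶠ w in 𝓝[≠] (x : ℂ), w ∈ resolventSet ℂ H}
  have hdich : ∀ x : ℝ, (∀ᶠ w in 𝓝 (x : ℂ), w ∈ spectrum ℂ H) ∨ x ∈ S := fun x => by
    obtain ⟨V, hV, Φ, Ψ, h, -⟩ := exists_finiteRank_perturbation hJ hH x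
    exact eventually_mem_spectrum_or_resolventSet h rfl
  have hρ : ∀ w ∈ resolventSet ℂ H, ∀ᶠ w' in 𝓝[≠] w, w' ∈ resolventSet ℂ H := fun w hw =>
    mem_nhdsWithin_of_mem_nhds ((spectrum.isOpen_resolventSet H).mem_nhds hw)
  have hopen : IsOpen S := by
    rw [isOpen_iff_mem_nhds]
    intro y hy
    have h1 := eventually_nhdsWithin_iff.1 hy
    filter_upwards [Complex.continuous_ofReal.continuousAt.eventually h1] with y' hy'
    by_cases e : (y' : ℂ) = y
    · rw [Complex.ofReal_inj.1 e]; exact hy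
    · exact hρ _ (hy' e)
  have hclosed : IsClosed S := by
    rw [← isOpen_compl_iff, isOpen_iff_mem_nhds]
    intro y hy
    have h1 := ((hdich y).resolve_right hy).eventually_nhds
    filter_upwards [Complex.continuous_ofReal.continuousAt.eventually h1] with y' hy' hS
    have h2 : ∀ᶠ w in 𝓝[≠] (y' : ℂ), w ∈ spectrum ℂ H := mem_nhdsWithin_of_mem_nhds hy'
    obtain ⟨w, hw1, hw2⟩ := (h2.and hS).exists
    exact hw1 hw2
  have hne : S.Nonempty := by
    refine ⟨‖H‖ + 1, hρ _ (mem_resolventSet_of_norm_lt_norm ?_)⟩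
    rw [Complex.norm_real, Real.norm_of_nonneg (by positivity)]
    linarith
  have : S = Set.univ := IsClopen.eq_univ ⟨hclosed, hopen⟩ hne
  exact (this.symm ▸ Set.mem_univ x : x ∈ S)

theorem finite_real_spectrum (hJ : IsFundamentalSymmetry J) (hH : H ∈ fredholmJHermitian J) :
    {x : ℝ | (x : ℂ) ∈ spectrum ℂ H}.Finite := by
  by_contra hinf
  have hsub : {x : ℝ | (x : ℂ) ∈ spectrum ℂ H} ⊆ closedBall 0 ‖H‖ := by
    intro x hx
    rw [mem_closedBall_zero_iff]
    by_contra h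
    exact hx (mem_resolventSet_of_norm_lt_norm (by rw [Complex.norm_real]; exact not_le.1 h))
  obtain ⟨x, -, hx⟩ := Set.Infinite.exists_accPt_of_subset_isCompact hinf
    (isCompact_closedBall 0 ‖H‖) hsub
  rw [accPt_iff_frequently] at hx
  have h1 := eventually_nhdsWithin_iff.1 (eventually_mem_resolventSet hJ hH x)
  obtain ⟨y, ⟨hy1, hy2⟩, hy3⟩ :=
    (hx.and_eventually (Complex.continuous_ofReal.continuousAt.eventually h1)).exists
  exact hy2 (hy3 fun h => hy1 (Complex.ofReal_inj.1 h))

theorem exists_isSeparatingRadius (hJ : IsFundamentalSymmetry J)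
    (hH : H ∈ fredholmJHermitian J) (x : ℝ) : ∃ r, IsSeparatingRadius H (x : ℂ) r := by
  obtain ⟨ε, hε, h⟩ := Metric.eventually_nhds_iff.1
    (eventually_nhdsWithin_iff.1 (eventually_mem_resolventSet hJ hH x))
  refine ⟨ε / 2, by positivity, fun w hw => ?_⟩
  by_contra hne
  exact hw.1 (h ((mem_closedBall.1 hw.2).trans_lt (by linarith)) hne)

theorem rieszSpace_ofReal (hJ : IsFundamentalSymmetry J) (hH : H ∈ fredholmJHermitian J)
    (x : ℝ) : rieszSpace H (x : ℂ) = genSpace H x ∧ FiniteDimensional ℂ (rieszSpace H (x : ℂ)) := by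
  obtain ⟨B, hB, hc⟩ := exists_compact_perturbation hJ hH x
  exact rieszSpace_eq_genSpace (exists_isSeparatingRadius hJ hH x) hB hc

/-- The perturbation factors through a space `V` of eigenvectors. If `V` were trivial, no
perturbation would be needed and `x` would lie in the resolvent set. -/
theorem hasEigenvalue_of_mem_spectrum (hJ : IsFundamentalSymmetry J)
    (hH : H ∈ fredholmJHermitian J) {x : ℝ} (hx : (x : ℂ) ∈ spectrum ℂ H) :
    Module.End.HasEigenvalue (H : K →ₗ[ℂ] K) (x : ℂ) := by
  obtain ⟨V, hV, Φ, Ψ, h, hev⟩ := exists_finiteRank_perturbation hJ hH x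
  by_cases hbot : V = ⊥
  · subst hbot
    exfalso
    have : Ψ = 0 := by ext v
    rw [this, ContinuousLinearMap.comp_zero, add_zero] at h
    exact hx h
  · obtain ⟨v, hv, hv0⟩ := Submodule.exists_mem_ne_zero_of_ne_bot hbot
    exact Module.End.hasEigenvalue_of_hasEigenvector
      ⟨Module.End.mem_eigenspace_iff.2 (hev v hv), hv0⟩

theorem isDiscreteEigenvalue_of_mem_spectrum (hJ : IsFundamentalSymmetry J)
    (hH : H ∈ fredholmJHermitian J) {x : ℝ} (hx : (x : ℂ) ∈ spectrum ℂ H) :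
    IsDiscreteEigenvalue H (x : ℂ) where
  hasEigenvalue := hasEigenvalue_of_mem_spectrum hJ hH hx
  isolated := by
    obtain ⟨r, hr, h⟩ := exists_isSeparatingRadius hJ hH x
    refine ⟨r, hr, h.antisymm ?_⟩
    rintro _ rfl
    exact ⟨hx, mem_closedBall_self hr.le⟩
  finiteDimensional := (rieszSpace_ofReal hJ hH x).2

end JHermitian

/-! ### Inertia of the form of `J` on finite dimensional subspaces. -/

section Inertia

variable {K : Type*} [NormedAddCommGroup K] [InnerProductSpace ℂ K] [CompleteSpace K]

/-- The hermitian form of `J` is positive definite on the subspace `P`. -/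
def IsPosOn (J : K →L[ℂ] K) (P : Submodule ℂ K) : Prop :=
  ∀ v ∈ P, v ≠ 0 → 0 < (⟪v, J v⟫_ℂ).re

/-- The hermitian form of `J` is negative definite on the subspace `N`. -/
def IsNegOn (J : K →L[ℂ] K) (N : Submodule ℂ K) : Prop :=
  ∀ v ∈ N, v ≠ 0 → (⟪v, J v⟫_ℂ).re < 0

/-- The form of `J` on `E` is nondegenerate with inertia `(p, q)`: there are a positive definite
subspace of dimension `p` and a negative definite one of dimension `q`, and `p + q = dim E`. -/
def HasInertia (J : K →L[ℂ] K) (E : Submodule ℂ K) (p q : ℕ) : Prop :=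
  ∃ P N : Submodule ℂ K, P ≤ E ∧ N ≤ E ∧ Module.finrank ℂ P = p ∧ Module.finrank ℂ N = q ∧
    p + q = Module.finrank ℂ E ∧ IsPosOn J P ∧ IsNegOn J N

/-- The form of `J` restricted to `E` is nondegenerate. -/
def IsNondegenerateOn (J : K →L[ℂ] K) (E : Submodule ℂ K) : Prop :=
  ∀ v ∈ E, (∀ w ∈ E, ⟪w, J v⟫_ℂ = 0) → v = 0

variable {J : K →L[ℂ] K} {E : Submodule ℂ K}

theorem finrank_add_le_of_disjoint {A B : Submodule ℂ K} [FiniteDimensional ℂ E] (hA : A ≤ E)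
    (hB : B ≤ E) (h : Disjoint A B) :
    Module.finrank ℂ A + Module.finrank ℂ B ≤ Module.finrank ℂ E := by
  have := Submodule.finiteDimensional_of_le hA
  have := Submodule.finiteDimensional_of_le hB
  have h1 := Submodule.finrank_sup_add_finrank_inf_eq A B
  rw [h.eq_bot, finrank_bot, add_zero] at h1
  rw [← h1]
  exact Submodule.finrank_mono (sup_le hA hB)

/-- The compression of `J` to the finite dimensional subspace `E`. -/
def compression (J : K →L[ℂ] K) (E : Submodule ℂ K) [FiniteDimensional ℂ E] : E →ₗ[ℂ] E :=
  (E.orthogonalProjectionOnto ∘L J ∘L E.subtypeL : E →L[ℂ] E)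

theorem inner_compression [FiniteDimensional ℂ E] (v w : E) :
    ⟪v, compression J E w⟫_ℂ = ⟪(v : K), J w⟫_ℂ := by
  change ⟪v, E.orthogonalProjectionOnto (J w)⟫_ℂ = _
  rw [Submodule.inner_orthogonalProjectionOnto_eq_of_mem_left]

theorem isSymmetric_compression [FiniteDimensional ℂ E]
    (hJ : ∀ x y, ⟪J x, y⟫_ℂ = ⟪x, J y⟫_ℂ) : (compression J E).IsSymmetric := by
  intro v w
  rw [inner_compression, ← inner_conj_symm, inner_compression, inner_conj_symm, hJ]

theorem finrank_formEigenspace [FiniteDimensional ℂ E] (t : ℝ) :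
    Module.finrank ℂ (formEigenspace J E t) =
      Module.finrank ℂ (Module.End.eigenspace (compression J E) (t : ℂ)) := by
  have : formEigenspace J E t =
      (Module.End.eigenspace (compression J E) (t : ℂ)).map E.subtype := by
    ext v
    constructor
    · rintro ⟨hv, h⟩
      refine ⟨⟨v, hv⟩, Module.End.mem_eigenspace_iff.2 (ext_inner_left ℂ fun w => ?_), rfl⟩
      rw [inner_compression, inner_smul_right]
      exact h w w.2
    · rintro ⟨v, hv, rfl⟩
      refine ⟨v.2, fun w hw => ?_⟩
      have h1 := inner_compression (J := J) (⟨w, hw⟩ : E) v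
      rw [Module.End.mem_eigenspace_iff.1 hv, inner_smul_right] at h1
      exact h1.symm
  rw [this]
  exact (Submodule.equivMapOfInjective _ E.injective_subtype _).symm.finrank_eq

/-- Only values of `f` give nonempty fibres, so the sum over the reals collapses to its finite
image. This matches the sums defining the inertia with counts of eigenvalues indexed by `Fin n`. -/
theorem finsum_card_fiber {n : ℕ} (f : Fin n → ℝ) (p : ℝ → Prop) [DecidablePred p] :
    ∑ᶠ (t : ℝ) (_ : p t), (Finset.univ.filter fun i => f i = t).card =
      (Finset.univ.filter fun i => p (f i)).card := by
  classical
  have h1 : ∑ᶠ (t : ℝ) (_ : p t), (Finset.univ.filter fun i => f i = t).card =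
      ∑ t ∈ (Finset.univ.image f).filter p, (Finset.univ.filter fun i => f i = t).card := by
    refine finsum_mem_eq_sum_of_inter_support_eq (s := {t | p t}) _ (Set.ext fun t => ?_)
    simp only [Set.mem_inter_iff, Set.mem_ofPred_eq, Function.mem_support, ne_eq,
      Finset.card_eq_zero, Finset.coe_filter, Finset.mem_image, Finset.mem_univ, true_and]
    refine ⟨fun ⟨ht, h⟩ => ⟨⟨?_, ht⟩, h⟩, fun ⟨⟨_, ht⟩, h⟩ => ⟨ht, h⟩⟩
    obtain ⟨i, hi⟩ := Finset.nonempty_iff_ne_empty.2 h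
    exact ⟨i, (Finset.mem_filter.1 hi).2⟩
  rw [h1, Finset.card_eq_sum_card_fiberwise (f := f) (t := (Finset.univ.image f).filter p)]
  · refine Finset.sum_congr rfl fun t ht => ?_
    rw [Finset.filter_filter]
    congr 1
    refine Finset.filter_congr fun i _ => ?_
    exact ⟨fun h => ⟨h ▸ (Finset.mem_filter.1 ht).2, h⟩, fun h => h.2⟩
  · intro i hi
    simpa using hi

theorem inner_compression_self_eq_sum [FiniteDimensional ℂ E]
    (hJ : ∀ x y, ⟪J x, y⟫_ℂ = ⟪x, J y⟫_ℂ) (v : E) :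
    (⟪(v : K), J v⟫_ℂ).re = ∑ i, (isSymmetric_compression (E := E) hJ).eigenvalues rfl i *
      ‖⟪(isSymmetric_compression (E := E) hJ).eigenvectorBasis rfl i, v⟫_ℂ‖ ^ 2 := by
  set hT := isSymmetric_compression (E := E) hJ
  rw [← inner_compression, ← (hT.eigenvectorBasis rfl).sum_inner_mul_inner, Complex.re_sum]
  refine Finset.sum_congr rfl fun i _ => ?_
  rw [← hT, hT.apply_eigenvectorBasis, inner_smul_left, ← inner_conj_symm v, mul_left_comm,
    ← Complex.normSq_eq_conj_mul_self, Complex.normSq_eq_norm_sq]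
  simp only [Complex.coe_algebraMap, Complex.conj_ofReal]
  norm_cast

/-- The span of the eigenvectors of the compression with index in `S`. -/
theorem exists_submodule_of_finset [FiniteDimensional ℂ E]
    (hJ : ∀ x y, ⟪J x, y⟫_ℂ = ⟪x, J y⟫_ℂ) (S : Finset (Fin (Module.finrank ℂ E))) :
    ∃ W : Submodule ℂ K, W ≤ E ∧ Module.finrank ℂ W = S.card ∧ ∀ v ∈ W, v ≠ 0 →
      ∃ c : Fin (Module.finrank ℂ E) → ℝ, (∀ i, 0 ≤ c i) ∧ (∃ i ∈ S, 0 < c i) ∧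
        (⟪v, J v⟫_ℂ).re = ∑ i ∈ S, (isSymmetric_compression (E := E) hJ).eigenvalues rfl i * c i := by
  set hT := isSymmetric_compression (E := E) hJ
  set b := hT.eigenvectorBasis rfl with hb
  refine ⟨(Submodule.span ℂ (b '' S)).map E.subtype, Submodule.map_subtype_le _ _, ?_, ?_⟩
  · rw [← (Submodule.equivMapOfInjective _ E.injective_subtype _).finrank_eq]
    have h1 : LinearIndependent ℂ (fun i : S => b i) :=
      b.orthonormal.linearIndependent.comp _ Subtype.val_injective
    have h2 := finrank_span_eq_card h1
    rw [Fintype.card_coe] at h2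
    rw [← h2, show (fun i : S => b i) = b ∘ (Subtype.val : S → _) from rfl, Set.range_comp,
      Subtype.range_coe_subtype]
    rfl
  · rintro _ ⟨v, hv, rfl⟩ hv0
    have hz : ∀ i ∉ S, ⟪b i, v⟫_ℂ = 0 := by
      intro i hi
      refine Submodule.span_induction (p := fun x _ => ⟪b i, x⟫_ℂ = 0) ?_ (inner_zero_right _)
        (fun x y _ _ hx hy => by rw [inner_add_right, hx, hy, add_zero])
        (fun a x _ hx => by rw [inner_smul_right, hx, mul_zero]) hv
      rintro _ ⟨j, hj, rfl⟩
      exact b.orthonormal.2 fun hij => hi (hij ▸ hj)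
    refine ⟨fun i => ‖⟪b i, v⟫_ℂ‖ ^ 2, fun i => by positivity, ?_, ?_⟩
    · by_contra! hcon
      refine hv0 ?_
      have : v = 0 := by
        refine b.repr.map_eq_zero_iff.1 (PiLp.ext fun i => ?_)
        rw [b.repr_apply_apply]
        by_cases hi : i ∈ S
        · simpa using hcon i hi
        · exact hz i hi
      rw [this, map_zero]
    · change (⟪(v : K), J v⟫_ℂ).re = _
      rw [inner_compression_self_eq_sum hJ]
      refine (Finset.sum_subset (Finset.subset_univ S) fun i _ hi => ?_).symm
      rw [hz i hi]
      simp

theorem positiveInertia_eq_card [FiniteDimensional ℂ E]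
    (hJ : ∀ x y, ⟪J x, y⟫_ℂ = ⟪x, J y⟫_ℂ) :
    positiveInertia J E = (Finset.univ.filter fun i =>
      0 < (isSymmetric_compression (E := E) hJ).eigenvalues rfl i).card := by
  rw [← finsum_card_fiber _ (fun t => 0 < t), positiveInertia]
  simp only [finrank_formEigenspace,
    ← (isSymmetric_compression (E := E) hJ).card_filter_eigenvalues_eq rfl]
  simp only [Complex.coe_algebraMap, Complex.ofReal_inj]

theorem negativeInertia_eq_card [FiniteDimensional ℂ E]
    (hJ : ∀ x y, ⟪J x, y⟫_ℂ = ⟪x, J y⟫_ℂ) :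
    negativeInertia J E = (Finset.univ.filter fun i =>
      (isSymmetric_compression (E := E) hJ).eigenvalues rfl i < 0).card := by
  rw [← finsum_card_fiber _ (fun t => t < 0), negativeInertia]
  simp only [finrank_formEigenspace,
    ← (isSymmetric_compression (E := E) hJ).card_filter_eigenvalues_eq rfl]
  simp only [Complex.coe_algebraMap, Complex.ofReal_inj]

theorem exists_isPosOn [FiniteDimensional ℂ E] (hJ : ∀ x y, ⟪J x, y⟫_ℂ = ⟪x, J y⟫_ℂ) :
    ∃ P ≤ E, Module.finrank ℂ P = positiveInertia J E ∧ IsPosOn J P := by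
  obtain ⟨W, hW, hf, h⟩ := exists_submodule_of_finset hJ (Finset.univ.filter fun i =>
      0 < (isSymmetric_compression (E := E) hJ).eigenvalues rfl i)
  refine ⟨W, hW, hf.trans (positiveInertia_eq_card hJ).symm, fun v hv hv0 => ?_⟩
  obtain ⟨c, hc, ⟨i, hi, hci⟩, e⟩ := h v hv hv0
  rw [e]
  refine Finset.sum_pos' (fun j hj => mul_nonneg (Finset.mem_filter.1 hj).2.le (hc j))
    ⟨i, hi, mul_pos (Finset.mem_filter.1 hi).2 hci⟩

theorem exists_isNegOn [FiniteDimensional ℂ E] (hJ : ∀ x y, ⟪J x, y⟫_ℂ = ⟪x, J y⟫_ℂ) :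
    ∃ N ≤ E, Module.finrank ℂ N = negativeInertia J E ∧ IsNegOn J N := by
  obtain ⟨W, hW, hf, h⟩ := exists_submodule_of_finset hJ (Finset.univ.filter fun i =>
      (isSymmetric_compression (E := E) hJ).eigenvalues rfl i < 0)
  refine ⟨W, hW, hf.trans (negativeInertia_eq_card hJ).symm, fun v hv hv0 => ?_⟩
  obtain ⟨c, hc, ⟨i, hi, hci⟩, e⟩ := h v hv hv0
  rw [e]
  refine Finset.sum_neg' (fun j hj => mul_nonpos_of_nonpos_of_nonneg
    (Finset.mem_filter.1 hj).2.le (hc j)) ⟨i, hi, mul_neg_of_neg_of_pos (Finset.mem_filter.1 hi).2 hci⟩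

/-- A positive definite subspace meets the span of the eigenvectors with nonpositive eigenvalue
trivially, and that span has codimension `positiveInertia J E` in `E`. -/
theorem finrank_le_positiveInertia [FiniteDimensional ℂ E]
    (hJ : ∀ x y, ⟪J x, y⟫_ℂ = ⟪x, J y⟫_ℂ) {P : Submodule ℂ K} (hPE : P ≤ E) (hP : IsPosOn J P) :
    Module.finrank ℂ P ≤ positiveInertia J E := by
  obtain ⟨W, hW, hf, h⟩ := exists_submodule_of_finset hJ (Finset.univ.filter fun i =>
      ¬ 0 < (isSymmetric_compression (E := E) hJ).eigenvalues rfl i)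
  have hd : Disjoint P W := by
    refine Submodule.disjoint_def.2 fun v hvP hvW => ?_
    by_contra hv0
    obtain ⟨c, hc, -, e⟩ := h v hvW hv0
    refine (hP v hvP hv0).not_ge ?_
    rw [e]
    exact Finset.sum_nonpos fun j hj =>
      mul_nonpos_of_nonpos_of_nonneg (not_lt.1 (Finset.mem_filter.1 hj).2) (hc j)
  have h1 := finrank_add_le_of_disjoint hPE hW hd
  have h2 := Finset.card_filter_add_card_filter_not (s := Finset.univ) fun i =>
    0 < (isSymmetric_compression (E := E) hJ).eigenvalues rfl i
  rw [Finset.card_univ, Fintype.card_fin] at h2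
  rw [positiveInertia_eq_card hJ]
  omega

theorem finrank_le_negativeInertia [FiniteDimensional ℂ E]
    (hJ : ∀ x y, ⟪J x, y⟫_ℂ = ⟪x, J y⟫_ℂ) {N : Submodule ℂ K} (hNE : N ≤ E) (hN : IsNegOn J N) :
    Module.finrank ℂ N ≤ negativeInertia J E := by
  obtain ⟨W, hW, hf, h⟩ := exists_submodule_of_finset hJ (Finset.univ.filter fun i =>
      ¬ (isSymmetric_compression (E := E) hJ).eigenvalues rfl i < 0)
  have hd : Disjoint N W := by
    refine Submodule.disjoint_def.2 fun v hvN hvW => ?_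
    by_contra hv0
    obtain ⟨c, hc, -, e⟩ := h v hvW hv0
    refine (hN v hvN hv0).not_ge ?_
    rw [e]
    exact Finset.sum_nonneg fun j hj =>
      mul_nonneg (not_lt.1 (Finset.mem_filter.1 hj).2) (hc j)
  have h1 := finrank_add_le_of_disjoint hNE hW hd
  have h2 := Finset.card_filter_add_card_filter_not (s := Finset.univ) fun i =>
    (isSymmetric_compression (E := E) hJ).eigenvalues rfl i < 0
  rw [Finset.card_univ, Fintype.card_fin] at h2
  rw [negativeInertia_eq_card hJ]
  omega

theorem IsPosOn.disjoint {P N : Submodule ℂ K} (hP : IsPosOn J P) (hN : IsNegOn J N) :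
    Disjoint P N := by
  refine Submodule.disjoint_def.2 fun v hvP hvN => ?_
  by_contra hv0
  exact (hP v hvP hv0).not_gt (hN v hvN hv0)

/-- Sylvester's law of inertia. -/
theorem HasInertia.inertia_eq [FiniteDimensional ℂ E] (hJ : ∀ x y, ⟪J x, y⟫_ℂ = ⟪x, J y⟫_ℂ)
    {p q : ℕ} (h : HasInertia J E p q) : positiveInertia J E = p ∧ negativeInertia J E = q := by
  obtain ⟨P, N, hPE, hNE, rfl, rfl, hpq, hP, hN⟩ := h
  have h1 := finrank_le_positiveInertia hJ hPE hP
  have h2 := finrank_le_negativeInertia hJ hNE hN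
  obtain ⟨P', hP'E, hP'f, hP'⟩ := exists_isPosOn (E := E) hJ
  obtain ⟨N', hN'E, hN'f, hN'⟩ := exists_isNegOn (E := E) hJ
  -- The two inertia indices dominate `p` and `q`, while their sum is at most `dim E = p + q`; both
  -- inequalities are equalities.
  have h3 := finrank_add_le_of_disjoint hP'E hN'E (hP'.disjoint hN')
  omega

/-- An eigenvector of the compression with eigenvalue zero would lie in the radical, so the positive
and negative counts exhaust the dimension. -/
theorem IsNondegenerateOn.hasInertia [FiniteDimensional ℂ E]
    (hJ : ∀ x y, ⟪J x, y⟫_ℂ = ⟪x, J y⟫_ℂ) (h : IsNondegenerateOn J E) :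
    HasInertia J E (positiveInertia J E) (negativeInertia J E) := by
  obtain ⟨P, hPE, hPf, hP⟩ := exists_isPosOn (E := E) hJ
  obtain ⟨N, hNE, hNf, hN⟩ := exists_isNegOn (E := E) hJ
  refine ⟨P, N, hPE, hNE, hPf, hNf, ?_, hP, hN⟩
  set hT := isSymmetric_compression (E := E) hJ with hTdef
  have hne : ∀ i, hT.eigenvalues rfl i ≠ 0 := by
    intro i hi
    have h1 := hT.apply_eigenvectorBasis rfl i
    rw [hi] at h1
    have h2 : ((hT.eigenvectorBasis rfl i : E) : K) = 0 := by
      refine h _ (Subtype.mem _) fun w hw => ?_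
      have := inner_compression (J := J) (⟨w, hw⟩ : E) (hT.eigenvectorBasis rfl i)
      rw [h1] at this
      simpa using this.symm
    have h3 := (hT.eigenvectorBasis rfl).orthonormal.ne_zero i
    exact h3 (Subtype.ext h2)
  have h2 := Finset.card_filter_add_card_filter_not (s := Finset.univ) fun i =>
    0 < hT.eigenvalues rfl i
  rw [Finset.card_univ, Fintype.card_fin] at h2
  rw [positiveInertia_eq_card hJ, negativeInertia_eq_card hJ]
  refine Eq.trans (congrArg₂ _ rfl (congrArg _ ?_)) h2
  refine Finset.filter_congr fun i _ => ?_
  rw [not_lt]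
  exact ⟨le_of_lt, fun h => lt_of_le_of_ne h (hne i)⟩

/-- Inertia is additive for sums of subspaces that are orthogonal for the form. -/
theorem HasInertia.sup {E₁ E₂ : Submodule ℂ K} [FiniteDimensional ℂ E₁] [FiniteDimensional ℂ E₂]
    (hJ : ∀ x y, ⟪J x, y⟫_ℂ = ⟪x, J y⟫_ℂ) {p₁ q₁ p₂ q₂ : ℕ}
    (h₁ : HasInertia J E₁ p₁ q₁) (h₂ : HasInertia J E₂ p₂ q₂) (hd : Disjoint E₁ E₂)
    (ho : ∀ v ∈ E₁, ∀ w ∈ E₂, ⟪v, J w⟫_ℂ = 0) :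
    HasInertia J (E₁ ⊔ E₂) (p₁ + p₂) (q₁ + q₂) := by
  obtain ⟨P₁, N₁, hP₁E, hN₁E, rfl, rfl, hpq₁, hP₁, hN₁⟩ := h₁
  obtain ⟨P₂, N₂, hP₂E, hN₂E, rfl, rfl, hpq₂, hP₂, hN₂⟩ := h₂
  have hf : ∀ {A B : Submodule ℂ K}, A ≤ E₁ → B ≤ E₂ →
      Module.finrank ℂ (A ⊔ B : Submodule ℂ K) = Module.finrank ℂ A + Module.finrank ℂ B := by
    intro A B hA hB
    have := Submodule.finiteDimensional_of_le hA
    have := Submodule.finiteDimensional_of_le hB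
    rw [← Submodule.finrank_sup_add_finrank_inf_eq, (hd.mono hA hB).eq_bot, finrank_bot, add_zero]
  have hq : ∀ v ∈ E₁, ∀ w ∈ E₂,
      (⟪v + w, J (v + w)⟫_ℂ).re = (⟪v, J v⟫_ℂ).re + (⟪w, J w⟫_ℂ).re := by
    intro v hv w hw
    have : ⟪w, J v⟫_ℂ = 0 := by rw [← hJ, ← inner_conj_symm, ho v hv w hw, map_zero]
    rw [map_add, inner_add_left, inner_add_right, inner_add_right, ho v hv w hw, this]
    simp
  refine ⟨P₁ ⊔ P₂, N₁ ⊔ N₂, sup_le_sup hP₁E hP₂E, sup_le_sup hN₁E hN₂E, hf hP₁E hP₂E,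
    hf hN₁E hN₂E, by rw [hf le_rfl le_rfl]; omega, fun x hx hx0 => ?_, fun x hx hx0 => ?_⟩
  · obtain ⟨v, hv, w, hw, rfl⟩ := Submodule.mem_sup.1 hx
    rw [hq v (hP₁E hv) w (hP₂E hw)]
    by_cases hv0 : v = 0
    · rw [hv0, zero_add] at hx0
      simpa [hv0] using hP₂ w hw hx0
    · by_cases hw0 : w = 0
      · simpa [hw0] using hP₁ v hv hv0
      · exact add_pos (hP₁ v hv hv0) (hP₂ w hw hw0)
  · obtain ⟨v, hv, w, hw, rfl⟩ := Submodule.mem_sup.1 hx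
    rw [hq v (hN₁E hv) w (hN₂E hw)]
    by_cases hv0 : v = 0
    · rw [hv0, zero_add] at hx0
      simpa [hv0] using hN₂ w hw hx0
    · by_cases hw0 : w = 0
      · simpa [hw0] using hN₁ v hv hv0
      · exact add_neg (hN₁ v hv hv0) (hN₂ w hw hw0)

/-- A nondegenerate form on the sum of two neutral subspaces has signature zero. -/
theorem HasInertia.eq_of_neutral [FiniteDimensional ℂ E] {p q : ℕ} (h : HasInertia J E p q)
    {L L' : Submodule ℂ K} (hE : E = L ⊔ L') (hL : ∀ v ∈ L, ⟪v, J v⟫_ℂ = 0)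
    (hL' : ∀ v ∈ L', ⟪v, J v⟫_ℂ = 0) : p = q := by
  obtain ⟨P, N, hPE, hNE, rfl, rfl, hpq, hP, hN⟩ := h
  have hLE : L ≤ E := hE ▸ le_sup_left
  have hL'E : L' ≤ E := hE ▸ le_sup_right
  have hPd : ∀ M : Submodule ℂ K, (∀ v ∈ M, ⟪v, J v⟫_ℂ = 0) → Disjoint P M := fun M hM => by
    refine Submodule.disjoint_def.2 fun v hvP hvM => ?_
    by_contra hv0
    exact (hP v hvP hv0).ne' (by rw [hM v hvM, Complex.zero_re])
  have hNd : ∀ M : Submodule ℂ K, (∀ v ∈ M, ⟪v, J v⟫_ℂ = 0) → Disjoint N M := fun M hM => by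
    refine Submodule.disjoint_def.2 fun v hvP hvM => ?_
    by_contra hv0
    exact (hN v hvP hv0).ne (by rw [hM v hvM, Complex.zero_re])
  -- Neutral subspaces miss both `P` and `N`, so `L` and `L'` have dimension at most `min p q`; as
  -- they span `E`, this gives `p + q ≤ 2 min p q`.
  have h1 := finrank_add_le_of_disjoint hPE hLE (hPd L hL)
  have h2 := finrank_add_le_of_disjoint hPE hL'E (hPd L' hL')
  have h3 := finrank_add_le_of_disjoint hNE hLE (hNd L hL)
  have h4 := finrank_add_le_of_disjoint hNE hL'E (hNd L' hL')
  have := Submodule.finiteDimensional_of_le hLE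
  have := Submodule.finiteDimensional_of_le hL'E
  have h5 := Submodule.finrank_add_le_finrank_add_finrank L L'
  rw [← hE] at h5
  omega

/-- Positivity is an open condition, uniform over the compact unit sphere of `A`; homogeneity of the
form extends it to all nonzero vectors. -/
theorem eventually_isPosOn_map {A : Submodule ℂ K} [FiniteDimensional ℂ A] (hA : IsPosOn J A)
    {P₀ : K →L[ℂ] K} (hP₀ : ∀ v ∈ A, P₀ v = v) :
    ∀ᶠ P in 𝓝 P₀, ∀ v ∈ A, v ≠ 0 → 0 < (⟪P v, J (P v)⟫_ℂ).re := by
  have : ProperSpace A := FiniteDimensional.proper ℂ A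
  have hc : IsCompact ((↑) '' (sphere (0 : A) 1) : Set K) :=
    (isCompact_sphere (0 : A) 1).image continuous_subtype_val
  have hcont : Continuous fun x : (K →L[ℂ] K) × K => (⟪x.1 x.2, J (x.1 x.2)⟫_ℂ).re := by
    fun_prop
  have h1 : ∀ᶠ P in 𝓝 P₀, ∀ v ∈ ((↑) '' (sphere (0 : A) 1) : Set K),
      0 < (⟪P v, J (P v)⟫_ℂ).re := by
    refine hc.eventually_forall_of_forall_eventually fun v hv => ?_
    obtain ⟨u, hu, rfl⟩ := hv
    refine hcont.continuousAt.eventually (lt_mem_nhds ?_)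
    simp only [hP₀ u u.2]
    refine hA u u.2 fun h0 => ?_
    have : u = 0 := Subtype.ext h0
    simp [this] at hu
  filter_upwards [h1] with P hP v hv hv0
  have hn : ‖v‖ ≠ 0 := norm_ne_zero_iff.2 hv0
  have h2 := hP (((‖v‖⁻¹ : ℝ) : ℂ) • v) ⟨((‖v‖⁻¹ : ℝ) : ℂ) • ⟨v, hv⟩, by
    simp [norm_smul, inv_mul_cancel₀ hn], rfl⟩
  rw [map_smul, map_smul, inner_smul_left, inner_smul_right, ← mul_assoc, Complex.conj_ofReal,
    ← Complex.ofReal_mul, Complex.re_ofReal_mul] at h2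
  exact (pos_iff_pos_of_mul_pos h2).1 (by positivity)

theorem isPosOn_neg : IsPosOn (-J) E ↔ IsNegOn J E := by
  refine forall₃_congr fun v _ _ => ?_
  simp [inner_neg_right]

/-- Inertia and rank are stable under small perturbations of an idempotent. -/
theorem HasInertia.eventually_range {P₀ : K →L[ℂ] K} (hP₀ : IsIdempotentElem P₀)
    (hfin : FiniteDimensional ℂ (P₀ : K →ₗ[ℂ] K).range) {p q : ℕ}
    (h : HasInertia J (P₀ : K →ₗ[ℂ] K).range p q) :
    ∀ᶠ P : K →L[ℂ] K in 𝓝 P₀, IsIdempotentElem P → FiniteDimensional ℂ (P : K →ₗ[ℂ] K).range ∧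
      HasInertia J (P : K →ₗ[ℂ] K).range p q := by
  obtain ⟨A, B, hAE, hBE, rfl, rfl, hpq, hA, hB⟩ := h
  have := Submodule.finiteDimensional_of_le hAE
  have := Submodule.finiteDimensional_of_le hBE
  have hfix : ∀ v ∈ (P₀ : K →ₗ[ℂ] K).range, P₀ v = v := fun v hv =>
    (mem_range_iff_of_isIdempotentElem hP₀).1 hv
  have e1 := eventually_isPosOn_map hA fun v hv => hfix v (hAE hv)
  have e2 := eventually_isPosOn_map (isPosOn_neg.2 hB) fun v hv => hfix v (hBE hv)
  have e3 : ∀ᶠ P in 𝓝 P₀, ‖P - P₀‖ < 1 := by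
    have : Tendsto (fun P : K →L[ℂ] K => ‖P - P₀‖) (𝓝 P₀) (𝓝 ‖P₀ - P₀‖) :=
      Continuous.tendsto (by fun_prop) P₀
    exact this.eventually_lt_const (by simp)
  filter_upwards [e1, e2, e3] with P h1 h2 h3 hP
  -- For `v` in the range of `Q` with `Q' v = 0` one has `‖v‖ = ‖(Q - Q') v‖`, so idempotents at
  -- distance less than 1 map each other's ranges injectively and have equal rank.
  have hinj : ∀ {Q Q' : K →L[ℂ] K}, IsIdempotentElem Q → ‖Q - Q'‖ < 1 → ∀ v,
      v ∈ (Q : K →ₗ[ℂ] K).range → Q' v = 0 → v = 0 := by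
    intro Q Q' hQ hQQ' v hv h0
    have e := (mem_range_iff_of_isIdempotentElem hQ).1 hv
    by_contra hv0
    have h4 := (Q - Q').le_opNorm v
    rw [sub_apply, e, h0, sub_zero] at h4
    have h5 : 0 < ‖v‖ := norm_pos_iff.2 hv0
    nlinarith
  let f : (P : K →ₗ[ℂ] K).range →ₗ[ℂ] (P₀ : K →ₗ[ℂ] K).range :=
    (P₀ : K →ₗ[ℂ] K).rangeRestrict ∘ₗ (P : K →ₗ[ℂ] K).range.subtype
  have hf : Function.Injective f := by
    rw [injective_iff_map_eq_zero]
    intro v hv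
    exact Subtype.ext (hinj hP h3 v v.2 (congrArg Subtype.val hv))
  let g : (P₀ : K →ₗ[ℂ] K).range →ₗ[ℂ] (P : K →ₗ[ℂ] K).range :=
    (P : K →ₗ[ℂ] K).rangeRestrict ∘ₗ (P₀ : K →ₗ[ℂ] K).range.subtype
  have hg : Function.Injective g := by
    rw [injective_iff_map_eq_zero]
    intro v hv
    exact Subtype.ext (hinj hP₀ (by rwa [norm_sub_rev]) v v.2 (congrArg Subtype.val hv))
  have hfinP : FiniteDimensional ℂ (P : K →ₗ[ℂ] K).range := FiniteDimensional.of_injective f hf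
  have hrank : Module.finrank ℂ (P₀ : K →ₗ[ℂ] K).range = Module.finrank ℂ (P : K →ₗ[ℂ] K).range :=
    le_antisymm (LinearMap.finrank_le_finrank_of_injective hg)
      (LinearMap.finrank_le_finrank_of_injective hf)
  have hmap : ∀ M : Submodule ℂ K, M ≤ (P₀ : K →ₗ[ℂ] K).range →
      Module.finrank ℂ (M.map (P : K →ₗ[ℂ] K)) = Module.finrank ℂ M := by
    intro M hM
    have hk : Function.Injective ((P : K →ₗ[ℂ] K).domRestrict M) := by
      rw [injective_iff_map_eq_zero]
      intro v hv
      exact Subtype.ext (hinj hP₀ (by rwa [norm_sub_rev]) v (hM v.2) hv)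
    rw [← LinearMap.finrank_range_of_inj hk, LinearMap.range_domRestrict]
  refine ⟨hfinP, A.map (P : K →ₗ[ℂ] K), B.map (P : K →ₗ[ℂ] K), LinearMap.map_le_range,
    LinearMap.map_le_range, hmap A hAE, hmap B hBE, hpq.trans hrank, ?_, ?_⟩
  · rintro _ ⟨v, hv, rfl⟩ hv0
    exact h1 v hv fun h0 => hv0 (by rw [h0, map_zero])
  · rw [← isPosOn_neg]
    rintro _ ⟨v, hv, rfl⟩ hv0
    exact h2 v hv fun h0 => hv0 (by rw [h0, map_zero])

end Inertia

/-! ### Additivity of the signature over form-orthogonal sums. -/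

section FormSignature

variable {K : Type*} [NormedAddCommGroup K] [InnerProductSpace ℂ K] [CompleteSpace K]

/-- The signature `ν₊ - ν₋` of the form of `J` on `E`. -/
def formSignature (J : K →L[ℂ] K) (E : Submodule ℂ K) : ℤ :=
  (positiveInertia J E : ℤ) - negativeInertia J E

/-- The subspaces `A` and `B` are orthogonal for the form of `J`. -/
def IsFormOrtho (J : K →L[ℂ] K) (A B : Submodule ℂ K) : Prop :=
  ∀ v ∈ A, ∀ w ∈ B, ⟪v, J w⟫_ℂ = 0

variable {J : K →L[ℂ] K} {A B C E : Submodule ℂ K}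

theorem IsFormOrtho.symm (hJ : ∀ x y, ⟪J x, y⟫_ℂ = ⟪x, J y⟫_ℂ) (h : IsFormOrtho J A B) :
    IsFormOrtho J B A := fun v hv w hw => by
  rw [← hJ, ← inner_conj_symm, h w hw v hv, map_zero]

/-- Orthogonality to one fixed vector `J w` cuts out a submodule, so it passes to suprema. -/
theorem IsFormOrtho.iSup_left {ι : Sort*} {f : ι → Submodule ℂ K}
    (h : ∀ i, IsFormOrtho J (f i) B) : IsFormOrtho J (⨆ i, f i) B := fun v hv w hw => by
  have : (⨆ i, f i) ≤ (ℂ ∙ J w)ᗮ := iSup_le fun i u hu =>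
    Submodule.mem_orthogonal_singleton_iff_inner_left.2 (h i u hu w hw)
  exact Submodule.mem_orthogonal_singleton_iff_inner_left.1 (this hv)

theorem IsFormOrtho.iSup_right (hJ : ∀ x y, ⟪J x, y⟫_ℂ = ⟪x, J y⟫_ℂ) {ι : Sort*}
    {f : ι → Submodule ℂ K} (h : ∀ i, IsFormOrtho J A (f i)) : IsFormOrtho J A (⨆ i, f i) :=
  (IsFormOrtho.iSup_left fun i => (h i).symm hJ).symm hJ

theorem IsFormOrtho.sup_right (hB : IsFormOrtho J A B) (hC : IsFormOrtho J A C) :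
    IsFormOrtho J A (B ⊔ C) := fun v hv w hw => by
  obtain ⟨x, hx, y, hy, rfl⟩ := Submodule.mem_sup.1 hw
  rw [map_add, inner_add_right, hB v hv x hx, hC v hv y hy, add_zero]

theorem IsNondegenerateOn.of_sup_left (h : IsNondegenerateOn J (A ⊔ B))
    (hBA : IsFormOrtho J B A) : IsNondegenerateOn J A := fun v hv hw => by
  refine h v (Submodule.mem_sup_left hv) fun w hw' => ?_
  obtain ⟨x, hx, y, hy, rfl⟩ := Submodule.mem_sup.1 hw'
  rw [inner_add_left, hw x hx, hBA y hy v hv, add_zero]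

/-- A common vector is form-orthogonal to both summands, hence lies in the radical of the sum. -/
theorem IsNondegenerateOn.disjoint (h : IsNondegenerateOn J (A ⊔ B))
    (hAB : IsFormOrtho J A B) (hBA : IsFormOrtho J B A) : Disjoint A B := by
  refine Submodule.disjoint_def.2 fun v hvA hvB => ?_
  refine h v (Submodule.mem_sup_left hvA) fun w hw => ?_
  obtain ⟨x, hx, y, hy, rfl⟩ := Submodule.mem_sup.1 hw
  rw [inner_add_left, hAB x hx v hvB, hBA y hy v hvA, add_zero]

theorem HasInertia.formSignature_eq [FiniteDimensional ℂ E]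
    (hJ : ∀ x y, ⟪J x, y⟫_ℂ = ⟪x, J y⟫_ℂ) {p q : ℕ} (h : HasInertia J E p q) :
    formSignature J E = p - q := by
  rw [formSignature, (h.inertia_eq hJ).1, (h.inertia_eq hJ).2]

theorem formSignature_bot (hJ : ∀ x y, ⟪J x, y⟫_ℂ = ⟪x, J y⟫_ℂ) :
    formSignature J (⊥ : Submodule ℂ K) = 0 := by
  have h : HasInertia J (⊥ : Submodule ℂ K) 0 0 :=
    ⟨⊥, ⊥, le_rfl, le_rfl, finrank_bot _ _, finrank_bot _ _, (finrank_bot _ _).symm,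
      fun v hv hv0 => absurd ((Submodule.mem_bot ℂ).1 hv) hv0,
      fun v hv hv0 => absurd ((Submodule.mem_bot ℂ).1 hv) hv0⟩
  simpa using h.formSignature_eq hJ

theorem formSignature_sup (hJ : ∀ x y, ⟪J x, y⟫_ℂ = ⟪x, J y⟫_ℂ)
    [FiniteDimensional ℂ (A ⊔ B : Submodule ℂ K)]
    (h : IsNondegenerateOn J (A ⊔ B)) (hAB : IsFormOrtho J A B) :
    formSignature J (A ⊔ B) = formSignature J A + formSignature J B := by
  have := Submodule.finiteDimensional_of_le (le_sup_left : A ≤ A ⊔ B)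
  have := Submodule.finiteDimensional_of_le (le_sup_right : B ≤ A ⊔ B)
  have hA := (h.of_sup_left (hAB.symm hJ)).hasInertia hJ
  have hB : IsNondegenerateOn J B := by
    rw [sup_comm] at h
    exact h.of_sup_left hAB
  have hB := hB.hasInertia hJ
  have hs := hA.sup hJ hB (h.disjoint hAB (hAB.symm hJ)) hAB
  rw [hs.formSignature_eq hJ, hA.formSignature_eq hJ, hB.formSignature_eq hJ]
  push_cast
  ring

theorem formSignature_finset_sup (hJ : ∀ x y, ⟪J x, y⟫_ℂ = ⟪x, J y⟫_ℂ) {ι : Type*}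
    (S : Finset ι) (f : ι → Submodule ℂ K) (hfin : FiniteDimensional ℂ (S.sup f : Submodule ℂ K))
    (h : IsNondegenerateOn J (S.sup f)) (ho : ∀ i j, i ≠ j → IsFormOrtho J (f i) (f j)) :
    formSignature J (S.sup f) = ∑ i ∈ S, formSignature J (f i) := by
  classical
  induction S using Finset.induction_on with
  | empty => simpa using formSignature_bot hJ
  | insert a s ha ih =>
    rw [Finset.sup_insert] at hfin h ⊢
    have horth : IsFormOrtho J (f a) (s.sup f) := by
      rw [Finset.sup_eq_iSup]
      refine IsFormOrtho.iSup_right hJ fun i => IsFormOrtho.iSup_right hJ fun hi => ho a i ?_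
      rintro rfl
      exact ha hi
    have hs : IsNondegenerateOn J (s.sup f) := by
      rw [sup_comm] at h
      exact h.of_sup_left horth
    rw [formSignature_sup hJ h horth, Finset.sum_insert ha,
      ih (Submodule.finiteDimensional_of_le (le_sup_right : s.sup f ≤ f a ⊔ s.sup f)) hs]

theorem formSignature_eq_zero_of_neutral (hJ : ∀ x y, ⟪J x, y⟫_ℂ = ⟪x, J y⟫_ℂ)
    [FiniteDimensional ℂ (A ⊔ B : Submodule ℂ K)] (h : IsNondegenerateOn J (A ⊔ B))
    (hA : IsFormOrtho J A A) (hB : IsFormOrtho J B B) : formSignature J (A ⊔ B) = 0 := by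
  have h1 := h.hasInertia hJ
  have h2 := h1.eq_of_neutral rfl (fun v hv => hA v hv v hv) (fun v hv => hB v hv v hv)
  rw [formSignature, h2, sub_self]

end FormSignature

/-! ### Krein signatures and their local constancy. -/

section Krein

variable {K : Type*} [NormedAddCommGroup K] [InnerProductSpace ℂ K] [CompleteSpace K]
  {J H : K →L[ℂ] K}

open scoped ComplexConjugate

/-- `H` is symmetric for the form, so moving `z - H` across it only conjugates the scalar. -/
theorem IsJHermitian.inner_pow_apply (hH : IsJHermitian J H) (z : ℂ) (n : ℕ) (v u : K) :
    ⟪((algebraMap ℂ (K →L[ℂ] K) z - H) ^ n) v, J u⟫_ℂ =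
      ⟪v, J (((algebraMap ℂ (K →L[ℂ] K) (conj z) - H) ^ n) u)⟫_ℂ := by
  induction n generalizing v u with
  | zero => simp
  | succ n ih =>
    rw [pow_succ, mul_apply_eq_comp, ih, pow_succ', mul_apply_eq_comp]
    generalize ((algebraMap ℂ (K →L[ℂ] K) (conj z) - H) ^ n) u = w
    simp only [Algebra.algebraMap_eq_smul_one, sub_apply, smul_apply, one_apply_eq_self, map_sub,
      map_smul, inner_sub_left, inner_sub_right, inner_smul_left, inner_smul_right, hH.inner_apply]

theorem isFormOrtho_genSpace (hH : IsJHermitian J H) {z w : ℂ} (hzw : w ≠ conj z) :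
    IsFormOrtho J (genSpace H z) (genSpace H w) := by
  intro v hv u hu
  obtain ⟨n, hn⟩ := mem_genSpace_iff.1 hv
  obtain ⟨m, hm⟩ := mem_genSpace_iff.1 hu
  -- A Bézout identity for these powers, evaluated at `H` and applied to `u`, writes `u` as `(conj z
  -- - H) ^ n` of some vector; moved across the form, this power annihilates `v`.
  have hc : IsCoprime ((Polynomial.C (conj z) - Polynomial.X) ^ n)
      ((Polynomial.C w - Polynomial.X) ^ m) := by
    refine IsCoprime.pow ?_
    have := (Polynomial.isCoprime_X_sub_C_of_isUnit_sub
      (isUnit_iff_ne_zero.2 (sub_ne_zero.2 hzw.symm))).neg_neg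
    simpa using this
  obtain ⟨a, b, hab⟩ := hc
  have h1 := congrArg (fun T : K →L[ℂ] K => T u) (congrArg (Polynomial.aeval H) hab)
  rw [mul_comm a] at h1
  simp only [map_add, map_mul, map_pow, map_sub, Polynomial.aeval_C, Polynomial.aeval_X, map_one,
    add_apply, mul_apply_eq_comp, hm, map_zero, add_zero, one_apply_eq_self] at h1
  rw [← h1, ← hH.inner_pow_apply, hn, inner_zero_left]

variable {c r : ℝ}

theorem conj_mem_ball {z : ℂ} (hz : z ∈ ball (c : ℂ) r) : conj z ∈ ball (c : ℂ) r := by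
  rw [mem_ball, Complex.dist_eq] at hz ⊢
  rwa [← Complex.conj_ofReal, ← map_sub, Complex.norm_conj]

/-- The form of `J` is nondegenerate on the range of the Riesz projection of a `J`-hermitian
operator for a circle that is symmetric with respect to the real axis. -/
theorem isNondegenerateOn_contourSpace (hJ : IsFundamentalSymmetry J) (hH : IsJHermitian J H)
    (hr : 0 < r) (h : sphere (c : ℂ) r ⊆ resolventSet ℂ H)
    (hfin : FiniteDimensional ℂ (contourSpace H c r)) :
    IsNondegenerateOn J (contourSpace H c r) := by
  -- The ranges of `P` and `1 - P` are form-orthogonal: with `z` also `conj z` lies in the disc, so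
  -- `1 - P` is divisible by `(conj z - H) ^ n` for every `n`. A vector in the radical is then
  -- form-orthogonal to all of `K`.
  have hker : ∀ v ∈ contourSpace H c r, ∀ u,
      ⟪v, J ((1 - contourProjection H (c : ℂ) r) u)⟫_ℂ = 0 := by
    intro v hv u
    rw [range_contourProjection_eq_iSup hr h hfin] at hv
    refine (IsFormOrtho.iSup_left (B := ℂ ∙ ((1 - contourProjection H (c : ℂ) r) u))
      fun z => IsFormOrtho.iSup_left fun hz => ?_) v hv _ (Submodule.mem_span_singleton_self _)
    intro x hx w hw
    obtain ⟨a, rfl⟩ := Submodule.mem_span_singleton.1 hw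
    obtain ⟨n, hn⟩ := mem_genSpace_iff.1 hx
    rw [one_sub_contourProjection_eq hr h (conj_mem_ball hz) n, ← map_smul, mul_apply_eq_comp,
      ← hH.inner_pow_apply, hn, inner_zero_left]
  intro v hv hw
  have h0 : J v = 0 := by
    refine ext_inner_left ℂ fun x => ?_
    have e : x = contourProjection H (c : ℂ) r x + (1 - contourProjection H (c : ℂ) r) x := by
      simp
    have hw' : ⟪contourProjection H (c : ℂ) r x, J v⟫_ℂ = 0 := hw _ ⟨x, rfl⟩
    rw [e, inner_add_left, hw', ← hJ.inner_left, ← inner_conj_symm, hker v hv,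
      map_zero, add_zero, inner_zero_right]
  rw [← hJ.apply_apply v, h0, map_zero]

/-- The signature of the range of the Riesz projection of a `J`-hermitian operator for a circle
with real center is the sum of the signatures of the real eigenvalues inside the circle. -/
theorem formSignature_contourSpace (hJ : IsFundamentalSymmetry J) (hH : IsJHermitian J H)
    (hr : 0 < r) (h : sphere (c : ℂ) r ⊆ resolventSet ℂ H)
    (hfin : FiniteDimensional ℂ (contourSpace H c r)) (S : Finset ℝ)
    (hS : ∀ x ∈ S, (x : ℂ) ∈ ball (c : ℂ) r)
    (hS' : ∀ x : ℝ, (x : ℂ) ∈ ball (c : ℂ) r → (x : ℂ) ∈ spectrum ℂ H → x ∈ S) :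
    formSignature J (contourSpace H c r) = ∑ x ∈ S, formSignature J (genSpace H (x : ℂ)) := by
  have hJs := hJ.inner_left
  set R : Submodule ℂ K := S.sup fun x : ℝ => genSpace H (x : ℂ) with hR
  have hRi : R = ⨆ x ∈ S, genSpace H ((x : ℝ) : ℂ) := Finset.sup_eq_iSup _ _
  set L : Submodule ℂ K := ⨆ (z : ℂ) (_ : z ∈ ball (c : ℂ) r ∧ 0 < z.im), genSpace H z with hL
  set L' : Submodule ℂ K := ⨆ (z : ℂ) (_ : z ∈ ball (c : ℂ) r ∧ z.im < 0), genSpace H z with hL'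
  have hE : contourSpace H c r = R ⊔ (L ⊔ L') := by
    rw [range_contourProjection_eq_iSup hr h hfin]
    refine le_antisymm (iSup₂_le fun z hz => ?_) (sup_le ?_ (sup_le ?_ ?_))
    · rcases lt_trichotomy z.im 0 with him | him | him
      · exact (le_iSup₂_of_le (f := fun z _ => genSpace H z) z ⟨hz, him⟩ le_rfl).trans
          (le_sup_right.trans le_sup_right)
      · have hzr : ((z.re : ℝ) : ℂ) = z := Complex.ext rfl (by simp [him])
        by_cases hs : z ∈ spectrum ℂ H
        · refine le_trans ?_ le_sup_left
          have := Finset.le_sup (f := fun x : ℝ => genSpace H (x : ℂ))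
            (hS' z.re (by rwa [hzr]) (by rwa [hzr]))
          simpa only [hzr] using this
        · rw [genSpace_eq_bot_of_mem_resolventSet (not_not.1 hs)]
          exact bot_le
      · exact (le_iSup₂_of_le (f := fun z _ => genSpace H z) z ⟨hz, him⟩ le_rfl).trans
          (le_sup_left.trans le_sup_right)
    · exact Finset.sup_le fun x hx => le_iSup₂_of_le (x : ℂ) (hS x hx) le_rfl
    · exact iSup₂_le fun z hz => le_iSup₂_of_le z hz.1 le_rfl
    · exact iSup₂_le fun z hz => le_iSup₂_of_le z hz.1 le_rfl
  have hnd := isNondegenerateOn_contourSpace hJ hH hr h hfin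
  rw [hE] at hnd hfin ⊢
  have hRL : IsFormOrtho J R L := by
    rw [hRi]
    refine IsFormOrtho.iSup_left fun x => IsFormOrtho.iSup_left fun _ =>
      IsFormOrtho.iSup_right hJs fun z => IsFormOrtho.iSup_right hJs fun hz =>
        isFormOrtho_genSpace hH ?_
    rintro rfl
    simp at hz
  have hRL' : IsFormOrtho J R L' := by
    rw [hRi]
    refine IsFormOrtho.iSup_left fun x => IsFormOrtho.iSup_left fun _ =>
      IsFormOrtho.iSup_right hJs fun z => IsFormOrtho.iSup_right hJs fun hz =>
        isFormOrtho_genSpace hH ?_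
    rintro rfl
    simp at hz
  -- Two points of the open upper half plane are never conjugate to each other.
  have hLL : IsFormOrtho J L L := by
    refine IsFormOrtho.iSup_left fun x => IsFormOrtho.iSup_left fun hx =>
      IsFormOrtho.iSup_right hJs fun z => IsFormOrtho.iSup_right hJs fun hz =>
        isFormOrtho_genSpace hH ?_
    rintro rfl
    have := hz.2
    rw [Complex.conj_im] at this
    linarith [hx.2]
  have hLL' : IsFormOrtho J L' L' := by
    refine IsFormOrtho.iSup_left fun x => IsFormOrtho.iSup_left fun hx =>
      IsFormOrtho.iSup_right hJs fun z => IsFormOrtho.iSup_right hJs fun hz =>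
        isFormOrtho_genSpace hH ?_
    rintro rfl
    have := hz.2
    rw [Complex.conj_im] at this
    linarith [hx.2]
  have hRM := hRL.sup_right hRL'
  have hndR : IsNondegenerateOn J R := hnd.of_sup_left (hRM.symm hJs)
  have hndM : IsNondegenerateOn J (L ⊔ L') := by
    rw [sup_comm] at hnd
    exact hnd.of_sup_left hRM
  have hfM : FiniteDimensional ℂ (L ⊔ L' : Submodule ℂ K) :=
    Submodule.finiteDimensional_of_le (le_sup_right : L ⊔ L' ≤ R ⊔ (L ⊔ L'))
  have hfR : FiniteDimensional ℂ R :=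
    Submodule.finiteDimensional_of_le (le_sup_left : R ≤ R ⊔ (L ⊔ L'))
  rw [formSignature_sup hJs hnd hRM, formSignature_eq_zero_of_neutral hJs hndM hLL hLL', add_zero]
  refine formSignature_finset_sup hJs S _ hfR hndR fun x y hxy => isFormOrtho_genSpace hH ?_
  rw [Complex.conj_ofReal]
  exact fun h => hxy (Complex.ofReal_inj.1 h).symm

theorem kreinSignature_eq_formSignature (hJ : IsFundamentalSymmetry J)
    (hH : H ∈ fredholmJHermitian J) (x : ℝ) :
    kreinSignature J H x = formSignature J (genSpace H (x : ℂ)) := by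
  rw [kreinSignature, (rieszSpace_ofReal hJ hH x).1, formSignature]

/-- Points of `S` outside the spectrum have trivial generalized eigenspace and add zero; real
spectral points are eigenvalues. -/
theorem globalKreinSignature_eq_sum (hJ : IsFundamentalSymmetry J)
    (hH : H ∈ fredholmJHermitian J) (S : Finset ℝ)
    (hS : ∀ x : ℝ, (x : ℂ) ∈ spectrum ℂ H → x ∈ S) :
    globalKreinSignature J H = ∑ x ∈ S, formSignature J (genSpace H (x : ℂ)) := by
  have h0 : ∀ x : ℝ, kreinSignature J H x ≠ 0 → (x : ℂ) ∈ spectrum ℂ H := by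
    intro x hx
    by_contra hn
    rw [kreinSignature_eq_formSignature hJ hH,
      genSpace_eq_bot_of_mem_resolventSet (not_not.1 hn), formSignature_bot hJ.inner_left] at hx
    exact hx rfl
  rw [← Finset.sum_congr rfl fun x _ => kreinSignature_eq_formSignature hJ hH x]
  refine finsum_mem_eq_sum_of_inter_support_eq
    (s := {x : ℝ | Module.End.HasEigenvalue (H : K →ₗ[ℂ] K) (x : ℂ)}) _ (Set.ext fun x => ?_)
  constructor
  · rintro ⟨-, hx⟩
    exact ⟨hS x (h0 x hx), hx⟩
  · rintro ⟨-, hx⟩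
    exact ⟨hasEigenvalue_of_mem_spectrum hJ hH (h0 x hx), hx⟩

theorem exists_radius (hJ : IsFundamentalSymmetry J) (hH : H ∈ fredholmJHermitian J) (x : ℝ)
    {ε : ℝ} (hε : 0 < ε) : ∃ r, r < ε ∧ IsSeparatingRadius H (x : ℂ) r ∧
      sphere (x : ℂ) r ⊆ resolventSet ℂ H ∧ FiniteDimensional ℂ (contourSpace H x r) := by
  obtain ⟨s, hs, hsep⟩ := exists_isSeparatingRadius hJ hH x
  obtain ⟨B, hB, hc⟩ := exists_compact_perturbation hJ hH x
  obtain ⟨δ, hδ, hδB⟩ := Metric.isOpen_iff.1 (spectrum.isOpen_resolventSet B) _ hB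
  -- Here `s` isolates `x` in the spectrum of `H`, `δ` keeps the disc in the resolvent set of `B`,
  -- and `ε` is the prescribed bound.
  have hr : 0 < min s (min δ ε / 2) := by positivity
  have hrδ : min s (min δ ε / 2) < min δ ε :=
    (min_le_right _ _).trans_lt (half_lt_self (by positivity))
  have hsep' : spectrum ℂ H ∩ closedBall (x : ℂ) (min s (min δ ε / 2)) ⊆ {(x : ℂ)} := fun w hw =>
    hsep ⟨hw.1, closedBall_subset_closedBall (min_le_left _ _) hw.2⟩
  have hsph : sphere (x : ℂ) (min s (min δ ε / 2)) ⊆ resolventSet ℂ H := fun w hw => by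
    by_contra hw'
    exact ne_of_mem_sphere hw hr.ne' (hsep' ⟨hw', sphere_subset_closedBall hw⟩)
  refine ⟨_, hrδ.trans_le (min_le_right _ _), ⟨hr, hsep'⟩, hsph,
    finiteDimensional_range_contourProjection hr hsph (fun w hw => hδB ?_) hc⟩
  exact closedBall_subset_ball (hrδ.trans_le (min_le_left _ _)) hw

/-- The signature of the range of the Riesz projection for a circle with real center is locally
constant. -/
theorem eventually_formSignature_contourSpace (hJ : IsFundamentalSymmetry J)
    (hH : IsJHermitian J H) (hr : 0 < r) (h : sphere (c : ℂ) r ⊆ resolventSet ℂ H)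
    (hfin : FiniteDimensional ℂ (contourSpace H c r)) :
    ∀ᶠ H' in 𝓝 H, sphere (c : ℂ) r ⊆ resolventSet ℂ H' ∧
      FiniteDimensional ℂ (contourSpace H' c r) ∧
      formSignature J (contourSpace H' c r) = formSignature J (contourSpace H c r) := by
  have hin := (isNondegenerateOn_contourSpace hJ hH hr h hfin).hasInertia hJ.inner_left
  have hev := HasInertia.eventually_range (isIdempotentElem_contourProjection hr h) hfin hin
  filter_upwards [eventually_subset_resolventSet (isCompact_sphere (c : ℂ) r) h,
    (continuousAt_contourProjection hr h).eventually hev] with H' h1 h2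
  obtain ⟨h3, h4⟩ := h2 (isIdempotentElem_contourProjection hr h1)
  have h3 : FiniteDimensional ℂ (contourSpace H' c r) := h3
  exact ⟨h1, h3, HasInertia.formSignature_eq hJ.inner_left h4⟩

theorem eventually_globalKreinSignature_eq (hJ : IsFundamentalSymmetry J)
    (hH : H ∈ fredholmJHermitian J) :
    ∀ᶠ H' in 𝓝 H, H' ∈ fredholmJHermitian J →
      globalKreinSignature J H' = globalKreinSignature J H := by
  classical
  have hfinS := finite_real_spectrum hJ hH
  set S := hfinS.toFinset with hS
  have hmemS : ∀ x : ℝ, x ∈ S ↔ (x : ℂ) ∈ spectrum ℂ H := fun x => hfinS.mem_toFinset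
  obtain ⟨U, hU, hdisj⟩ := hfinS.t2_separation
  have hε : ∀ x : ℝ, ∃ ε > 0, ball x ε ⊆ U x := fun x => Metric.isOpen_iff.1 (hU x).2 x (hU x).1
  choose ε hε hεU using hε
  choose r hrε hrsep hrsph hrfin using fun x : ℝ => exists_radius hJ hH x (hε x)
  have hballU : ∀ x y : ℝ, (y : ℂ) ∈ ball (x : ℂ) (r x) → y ∈ U x := fun x y hy => by
    refine hεU x (mem_ball.2 (lt_trans ?_ (hrε x)))
    rwa [mem_ball, Complex.dist_eq, ← Complex.ofReal_sub, Complex.norm_real] at hy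
  have e1 : ∀ᶠ H' in 𝓝 H, ∀ x ∈ S, sphere (x : ℂ) (r x) ⊆ resolventSet ℂ H' ∧
      FiniteDimensional ℂ (contourSpace H' x (r x)) ∧
      formSignature J (contourSpace H' x (r x)) = formSignature J (contourSpace H x (r x)) :=
    (Filter.eventually_all_finset S).2 fun x _ =>
      eventually_formSignature_contourSpace hJ hH.1 (hrsep x).1 (hrsph x) (hrfin x)
  -- The radius `‖H‖ + 1` bounds the spectrum of every `H'` with `‖H'‖ < ‖H‖ + 1`; once `C` lies in
  -- the resolvent set of `H'`, real spectrum of `H'` can occur only inside the discs.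
  let C : Set ℂ := ((↑) '' closedBall (0 : ℝ) (‖H‖ + 1)) \ ⋃ x ∈ S, ball ((x : ℝ) : ℂ) (r x)
  have hC : IsCompact C := ((isCompact_closedBall _ _).image Complex.continuous_ofReal).diff
    (isOpen_biUnion fun _ _ => isOpen_ball)
  have hCρ : C ⊆ resolventSet ℂ H := by
    rintro _ ⟨⟨y, -, rfl⟩, hy⟩
    by_contra hy'
    exact hy (Set.mem_biUnion (show y ∈ S from (hmemS y).2 hy') (mem_ball_self (hrsep y).1))
  have e3 : ∀ᶠ H' in 𝓝 H, ‖H'‖ < ‖H‖ + 1 :=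
    continuous_norm.continuousAt.eventually_lt_const (by linarith)
  filter_upwards [e1, eventually_subset_resolventSet hC hCρ, e3] with H' h1 h2 h3 hH'
  have hfinT := finite_real_spectrum hJ hH'
  set T := hfinT.toFinset with hT
  have hmemT : ∀ x : ℝ, x ∈ T ↔ (x : ℂ) ∈ spectrum ℂ H' := fun x => hfinT.mem_toFinset
  have hcover : T = S.biUnion fun x => T.filter fun y : ℝ => (y : ℂ) ∈ ball (x : ℂ) (r x) := by
    ext y
    simp only [Finset.mem_biUnion, Finset.mem_filter]
    refine ⟨fun hy => ?_, fun ⟨_, _, hy, _⟩ => hy⟩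
    by_contra! hcon
    refine (hmemT y).1 hy (h2 ⟨⟨y, ?_, rfl⟩, ?_⟩)
    · rw [mem_closedBall_zero_iff]
      by_contra hlt
      refine (hmemT y).1 hy (mem_resolventSet_of_norm_lt_norm ?_)
      rw [Complex.norm_real]
      linarith
    · simp only [Set.mem_iUnion, not_exists]
      exact fun x hx => hcon x hx hy
  rw [globalKreinSignature_eq_sum hJ hH S fun x hx => (hmemS x).2 hx,
    globalKreinSignature_eq_sum hJ hH' T fun x hx => (hmemT x).2 hx, hcover, Finset.sum_biUnion]
  · refine Finset.sum_congr rfl fun x hx => ?_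
    obtain ⟨g1, g2, g3⟩ := h1 x hx
    -- For `H'` each disc yields the sum over its real spectrum there; for `H` it yields the single
    -- term at the center.
    rw [← formSignature_contourSpace hJ hH'.1 (hrsep x).1 g1 g2 _
      (fun y hy => (Finset.mem_filter.1 hy).2)
      (fun y hy hy' => Finset.mem_filter.2 ⟨(hmemT y).2 hy', hy⟩), g3,
      formSignature_contourSpace hJ hH.1 (hrsep x).1 (hrsph x) (hrfin x) {x}, Finset.sum_singleton]
    · intro y hy
      rw [Finset.mem_singleton.1 hy]
      exact mem_ball_self (hrsep x).1
    · intro y hy hy'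
      have := (hrsep x).2 ⟨hy', ball_subset_closedBall hy⟩
      exact Finset.mem_singleton.2 (Complex.ofReal_inj.1 this)
  · intro x hx x' hx' hne
    refine Finset.disjoint_left.2 fun y hy hy' => ?_
    exact Set.disjoint_left.1 (hdisj ((hmemS x).1 hx) ((hmemS x').1 hx') hne)
      (hballU x y (Finset.mem_filter.1 hy).2) (hballU x' y (Finset.mem_filter.1 hy').2)

theorem continuous_globalKreinSignature (hJ : IsFundamentalSymmetry J) :
    Continuous fun H : fredholmJHermitian J => globalKreinSignature J (H : K →L[ℂ] K) := by
  refine continuous_iff_continuousAt.2 fun H => ?_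
  refine (continuousAt_const (y := globalKreinSignature J (H : K →L[ℂ] K))).congr ?_
  filter_upwards [continuous_subtype_val.continuousAt.eventually
    (eventually_globalKreinSignature_eq hJ H.2)] with H' h
  exact (h H'.2).symm

end Krein

end

theorem mainTheorem3 {K : Type*} [NormedAddCommGroup K] [InnerProductSpace ℂ K] [CompleteSpace K]
    [TopologicalSpace.SeparableSpace K] (J : K →L[ℂ] K) (hJ : IsFundamentalSymmetry J) :
    -- the defining sum is a finite sum over discrete eigenvalues
    (∀ H ∈ fredholmJHermitian J,
      {x : ℝ | (x : ℂ) ∈ spectrum ℂ H}.Finite ∧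
      ∀ x : ℝ, (x : ℂ) ∈ spectrum ℂ H → IsDiscreteEigenvalue H (x : ℂ)) ∧
    -- continuity in norm
    Continuous (fun H : fredholmJHermitian J => globalKreinSignature J (H : K →L[ℂ] K)) ∧
    -- homotopy invariance
    (∀ H₀ H₁ : fredholmJHermitian J, Joined H₀ H₁ →
      globalKreinSignature J (H₀ : K →L[ℂ] K) = globalKreinSignature J (H₁ : K →L[ℂ] K)) := by
  have hcont := continuous_globalKreinSignature hJ
  refine ⟨fun H hH => ⟨finite_real_spectrum hJ hH, fun x hx =>
    isDiscreteEigenvalue_of_mem_spectrum hJ hH hx⟩, hcont, fun H₀ H₁ ⟨γ⟩ => ?_⟩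
  -- A continuous integer-valued function on the unit interval is constant.
  have := PreconnectedSpace.constant inferInstance (hcont.comp γ.continuous) (x := 0) (y := 1)
  simpa using this
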